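/- Let $U\subset\mathbb C^2$ be open, with coordinates $(x,y)$, and let $n,m,\Delta,\Gamma$ be nonnegative integers with $\Delta\le n$ and $\Gamma\le m$. For $a,b\ge 0$ let $\mathcal R_{a,b}\subset C^\infty(U,\mathbb C)$ be the linear span of the monomials $x^iy^j$ with $0\le i\le a$, $0\le j\le b$. Put $(n_1,m_1)=(n-\Delta,m)$ and $(n_2,m_2)=(n,m-\Gamma)$. A $2\times2$ matrix differential operator $D=(D_{ij})$ on $U$ has entries that are finite sums $\sum f_{ab}(x,y)\,\partial_x^a\partial_y^b$ with $f_{ab}\in C^\infty(U,\mathbb C)$, where $\partial_x,\partial_y$ are the (Wirtinger) derivatives with respect to the complex coordinates $x,y$; it has order at most $k$ if only terms with $a+b\le k$ occur in its entries. Let $\tilde{\mathfrak R}$ (the distinguished complement) be the space of those $D$ that map $\mathcal R_{n_1,m_1}\oplus\mathcal R_{n_2,m_2}=\mathcal R_{n-\Delta,m}\oplus\mathcal R_{n,m-\Gamma}$ to itself and for which $D_{ij}$ contains only terms with $a\le n_j$ and $b\le m_j$, for all $i,j\in\{1,2\}$. For $\lambda\in\mathbb C$ let $$J^+_\lambda=x^2\partial_x-\lambda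 x,\quad J^-_\lambda=\partial_x,\quad J^0_\lambda=x\partial_x-\tfrac{\lambda}{2},\qquad K^+_\lambda=y^2\partial_y-\lambda y,\quad K^-_\lambda=\partial_y,\quad K^0_\lambda=y\partial_y-\tfrac{\lambda}{2},$$ and for $\epsilon\in\{+,-,0\}$ let $$S^\epsilon=\operatorname{diag}(J^\epsilon_{n-\Delta},J^\epsilon_n),\qquad T^\epsilon=\operatorname{diag}(K^\epsilon_m,K^\epsilon_{m-\Gamma}),\qquad \tilde J=\operatorname{diag}(1,-1).$$ With $\sigma^+=\begin{pmatrix}0&1\\0&0\end{pmatrix}$, $\sigma^-=\begin{pmatrix}0&0\\1&0\end{pmatrix}$, and for $0\le\alpha\le\Delta$, $0\le\beta\le\Gamma$, let $$Q^+_{\alpha\beta}=\Big(\prod_{l=1}^{\Delta-\alpha}(x\partial_x-n+\Delta-l)\Big)\partial_x^\alpha\; y^\beta\,\sigma^+,\qquad Q^-_{\alpha\beta}=x^\alpha\Big(\prod_{l=1}^{\Gamma-\beta}(y\partial_y-m+\Gamma-l)\Big)\partial_y^\beta\,\sigma^-$$ (empty products are $1$). Let $\mathcal B$ be the set of all monomials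 $$X(S^\mu)^i(S^0)^s(T^\nu)^j(T^0)^t,\quad Q^\varepsilon_{\alpha0}(S^{-\varepsilon})^i(T^\nu)^j(T^0)^t,\quad Q^\varepsilon_{0\beta}(S^\mu)^i(S^0)^s(T^\varepsilon)^j,\quad Q^\varepsilon_{\alpha\beta}(S^{-\varepsilon})^i(T^\varepsilon)^j,$$ where $X\in\{Q^+_{00},Q^-_{00},1,\tilde J\}$, $1$ is the identity matrix, $\mu,\nu,\varepsilon\in\{+,-\}$ are independent signs, $i,j,s,t\ge 0$, $1\le\alpha\le\Delta$ and $1\le\beta\le\Gamma$. Theorem. For every $k\ge 0$, every $D\in\tilde{\mathfrak R}$ of order at most $k$ is a (finite) $\mathbb C$-linear combination of elements of $\mathcal B$ that have order at most $k$. -/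

import Mathlib

open scoped ContDiff

noncomputable section

namespace RectMod

/-- Open subsets of `ℂ²`, with the standard coordinates `(x, y)`. -/
abbrev Dom := TopologicalSpace.Opens (ℂ × ℂ)

/-- Extension by zero of a function on `U`; its germs at the points of `U` are those of `f`. -/
def ext0 (U : Dom) (f : U → ℂ) : ℂ × ℂ → ℂ := Function.extend Subtype.val f 0

theorem ext0_apply (U : Dom) (f : U → ℂ) (p : U) : ext0 U f p = f p :=
  Subtype.val_injective.extend_apply f 0 p

theorem ext0_restrict_eqOn (U : Dom) (g : ℂ × ℂ → ℂ) :
    Set.EqOn (ext0 U (fun p => g p)) g U := fun p hp => ext0_apply U (fun p => g p) ⟨p, hp⟩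

/-- A function on `U` given by a formula that is smooth on `U`. -/
theorem smooth_restrict (U : Dom) {g : ℂ × ℂ → ℂ} (hg : ContDiffOn ℝ ∞ g U) :
    ContDiffOn ℝ ∞ (ext0 U (fun p => g p)) U :=
  hg.congr (ext0_restrict_eqOn U g)

/-- The algebra `C^∞(U, ℂ)` of complex-valued functions on `U` that are infinitely
differentiable in the real sense. -/
def Smooth (U : Dom) : Subalgebra ℂ (U → ℂ) where
  carrier := {f | ContDiffOn ℝ ∞ (ext0 U f) U}
  mul_mem' {f g} hf hg := (hf.mul hg).congr fun p hp => by
    have h := fun q => ext0_apply U q ⟨p, hp⟩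
    dsimp only at h
    rw [h, h, h]; rfl
  add_mem' {f g} hf hg := (hf.add hg).congr fun p hp => by
    have h := fun q => ext0_apply U q ⟨p, hp⟩
    dsimp only at h
    rw [h, h, h]; rfl
  algebraMap_mem' c := smooth_restrict U (g := fun _ => c) contDiffOn_const

/-- The coordinate function `x`. -/
def x (U : Dom) : Smooth U :=
  ⟨fun p => p.1.1, smooth_restrict U (g := fun p => p.1) contDiff_fst.contDiffOn⟩

/-- The coordinate function `y`. -/
def y (U : Dom) : Smooth U :=
  ⟨fun p => p.1.2, smooth_restrict U (g := fun p => p.2) contDiff_snd.contDiffOn⟩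

/-- The complex derivative `(1/2) (∂_v - i ∂_{iv})` along `v`, a `ℂ`-linear operator on
`C^∞(U, ℂ)`. On holomorphic functions it is the usual holomorphic directional derivative. -/
def wirtinger (U : Dom) (v : ℂ × ℂ) : Module.End ℂ (Smooth U) where
  toFun f := ⟨fun p => (1 / 2 : ℂ) * (fderiv ℝ (ext0 U f.1) p v
      - Complex.I * fderiv ℝ (ext0 U f.1) p (Complex.I • v)), by
    have hf : ContDiffOn ℝ ∞ (fderiv ℝ (ext0 U f.1)) U :=
      ContDiffOn.fderiv_of_isOpen f.2 U.isOpen (by simp)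
    exact smooth_restrict U (g := fun p => (1 / 2 : ℂ) * (fderiv ℝ (ext0 U f.1) p v
      - Complex.I * fderiv ℝ (ext0 U f.1) p (Complex.I • v)))
      (contDiffOn_const.mul ((hf.clm_apply contDiffOn_const).sub
        (contDiffOn_const.mul (hf.clm_apply contDiffOn_const))))⟩
  map_add' f g := by
    apply Subtype.ext
    funext p
    have hd : ∀ q : Smooth U, DifferentiableAt ℝ (ext0 U q.1) p := fun q =>
      (q.2.differentiableOn (by simp)).differentiableAt (U.isOpen.mem_nhds p.2)
    have e : ext0 U (f + g).1 =ᶠ[nhds (p : ℂ × ℂ)] (ext0 U f.1 + ext0 U g.1) :=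
      Filter.eventuallyEq_of_mem (U.isOpen.mem_nhds p.2) fun r hr => by
        have h := fun q => ext0_apply U q ⟨r, hr⟩
        simp only [Pi.add_apply] at *
        rw [h, h, h]; rfl
    have e' := e.fderiv_eq (𝕜 := ℝ)
    rw [fderiv_add (hd f) (hd g)] at e'
    dsimp only
    rw [e']
    simp only [Subalgebra.coe_add, Pi.add_apply, add_apply]
    ring
  map_smul' c f := by
    apply Subtype.ext
    funext p
    have hd : DifferentiableAt ℝ (ext0 U f.1) p :=
      (f.2.differentiableOn (by simp)).differentiableAt (U.isOpen.mem_nhds p.2)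
    have e : ext0 U (c • f).1 =ᶠ[nhds (p : ℂ × ℂ)] (c • ext0 U f.1) :=
      Filter.eventuallyEq_of_mem (U.isOpen.mem_nhds p.2) fun r hr => by
        have h := fun q => ext0_apply U q ⟨r, hr⟩
        simp only [Pi.smul_apply] at *
        rw [h, h]; rfl
    have e' := e.fderiv_eq (𝕜 := ℝ)
    rw [fderiv_const_smul hd] at e'
    dsimp only
    rw [e']
    simp only [RingHom.id_apply, Subalgebra.coe_smul, Pi.smul_apply, smul_apply, smul_eq_mul]
    ring

/-- Scalar operators: linear endomorphisms of `C^∞(U, ℂ)`, with composition as product. -/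
abbrev Op (U : Dom) := Module.End ℂ (Smooth U)

/-- `∂/∂x`. -/
def dx (U : Dom) : Op U := wirtinger U (1, 0)

/-- `∂/∂y`. -/
def dy (U : Dom) : Op U := wirtinger U (0, 1)

/-- The operator of multiplication by a smooth function. -/
def mulOp (U : Dom) (f : Smooth U) : Op U := LinearMap.mulLeft ℂ f

/-- `T` is a differential operator `∑ f_{ij} ∂_x^i ∂_y^j`, a finite sum with smooth coefficients
that runs over pairs `(i, j)` with `P i j`. -/
def IsDiffOpOn (U : Dom) (P : ℕ → ℕ → Prop) (T : Op U) : Prop :=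
  ∃ f : ℕ × ℕ →₀ Smooth U, (∀ p ∈ f.support, P p.1 p.2) ∧
    T = f.sum fun p g => mulOp U g * dx U ^ p.1 * dy U ^ p.2

/-- The scalar rectangular module `R_{n,m}`, spanned by `x^i y^j`, `0 ≤ i ≤ n`, `0 ≤ j ≤ m`. -/
def rect (U : Dom) (n m : ℕ) : Submodule ℂ (Smooth U) :=
  Submodule.span ℂ {f | ∃ i j : ℕ, i ≤ n ∧ j ≤ m ∧ f = x U ^ i * y U ^ j}

/-- `2 × 2` matrices of operators. -/
abbrev MatOp (U : Dom) := Matrix (Fin 2) (Fin 2) (Op U)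

/-- The action of a matrix of operators on pairs of functions. -/
def act (U : Dom) (T : MatOp U) (v : Fin 2 → Smooth U) : Fin 2 → Smooth U :=
  fun i => ∑ j, T i j (v j)

/-- The `x`-degree bounds `(n - Δ, n)` of the two components. -/
def xDeg (n Δ : ℕ) : Fin 2 → ℕ := ![n - Δ, n]

/-- The `y`-degree bounds `(m, m - Γ)` of the two components. -/
def yDeg (m Γ : ℕ) : Fin 2 → ℕ := ![m, m - Γ]

/-- The module `R_{n-Δ,m} ⊕ R_{n,m-Γ}`. -/
def rect2 (U : Dom) (n m Δ Γ : ℕ) : Submodule ℂ (Fin 2 → Smooth U) :=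
  Submodule.pi Set.univ fun i => rect U (xDeg n Δ i) (yDeg m Γ i)

/-- `T` is a matrix differential operator of order at most `k`. -/
def OrderLE (U : Dom) (k : ℕ) (T : MatOp U) : Prop :=
  ∀ i j, IsDiffOpOn U (fun a b => a + b ≤ k) (T i j)

/-- The distinguished complement: the matrix differential operators that preserve
`R_{n-Δ,m} ⊕ R_{n,m-Γ}` and whose entries in column `j` contain only derivatives
`∂_x^a ∂_y^b` with `a ≤ n_j`, `b ≤ m_j`, where `R_{n_j,m_j}` is the `j`-th summand. -/
def complementR (U : Dom) (n m Δ Γ : ℕ) : Set (MatOp U) :=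
  {T | (∀ v ∈ rect2 U n m Δ Γ, act U T v ∈ rect2 U n m Δ Γ) ∧
    ∀ i j, IsDiffOpOn U (fun a b => a ≤ xDeg n Δ j ∧ b ≤ yDeg m Γ j) (T i j)}

/-- Signs `±`. -/
inductive Sgn
  | plus
  | minus

/-- The opposite sign. -/
def Sgn.opp : Sgn → Sgn
  | .plus => .minus
  | .minus => .plus

/-- `X² D - c X` for the sign `+`, `D` for the sign `-`. -/
def slPM {A : Type*} [Ring A] [Algebra ℂ A] (X D : A) (c : ℂ) : Sgn → A
  | .plus => X ^ 2 * D - c • X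
  | .minus => D

/-- `X D - c/2`. -/
def slZero {A : Type*} [Ring A] [Algebra ℂ A] (X D : A) (c : ℂ) : A :=
  X * D - algebraMap ℂ A (c / 2)

/-- `∏_{k=1}^{Δ-α} (X D - n + Δ - k) · D^α` (the factors of the product commute). -/
def qbar {A : Type*} [Ring A] [Algebra ℂ A] (X D : A) (n Δ α : ℕ) : A :=
  ((List.range (Δ - α)).map fun k =>
    X * D - algebraMap ℂ A ((n : ℂ) - Δ + ((k : ℂ) + 1))).prod * D ^ α

/-- `S^± = diag(J^±_{n-Δ}, J^±_n)`. -/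
def S (U : Dom) (n Δ : ℕ) (ε : Sgn) : MatOp U :=
  Matrix.diagonal ![slPM (mulOp U (x U)) (dx U) ((n : ℂ) - Δ) ε,
    slPM (mulOp U (x U)) (dx U) n ε]

/-- `S^0 = diag(J^0_{n-Δ}, J^0_n)`. -/
def S0 (U : Dom) (n Δ : ℕ) : MatOp U :=
  Matrix.diagonal ![slZero (mulOp U (x U)) (dx U) ((n : ℂ) - Δ),
    slZero (mulOp U (x U)) (dx U) n]

/-- `T^± = diag(K^±_m, K^±_{m-Γ})`. -/
def T (U : Dom) (m Γ : ℕ) (ε : Sgn) : MatOp U :=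
  Matrix.diagonal ![slPM (mulOp U (y U)) (dy U) m ε,
    slPM (mulOp U (y U)) (dy U) ((m : ℂ) - Γ) ε]

/-- `T^0 = diag(K^0_m, K^0_{m-Γ})`. -/
def T0 (U : Dom) (m Γ : ℕ) : MatOp U :=
  Matrix.diagonal ![slZero (mulOp U (y U)) (dy U) m,
    slZero (mulOp U (y U)) (dy U) ((m : ℂ) - Γ)]

/-- `J̃ = σ₃ = diag(1, -1)`. -/
def Jtilde (U : Dom) : MatOp U := Matrix.diagonal ![1, -1]

/-- `Q^+_{αβ} = q̄_α(x, n, Δ) y^β σ^+` and `Q^-_{αβ} = x^α q̄_β(y, m, Γ) σ^-`, where `σ^+` is the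
matrix unit in position `(1, 2)` and `σ^-` its transpose. -/
def Q (U : Dom) (n m Δ Γ : ℕ) (ε : Sgn) (α β : ℕ) : MatOp U :=
  match ε with
  | .plus => !![0, qbar (mulOp U (x U)) (dx U) n Δ α * mulOp U (y U) ^ β; 0, 0]
  | .minus => !![0, 0; mulOp U (x U) ^ α * qbar (mulOp U (y U)) (dy U) m Γ β, 0]

/-- The four families of monomials; the signs of `S^±` and `T^±` are chosen independently,
and all exponents range over the nonnegative integers. -/
def basisR (U : Dom) (n m Δ Γ : ℕ) : Set (MatOp U) :=
  {M | ∃ X : MatOp U,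
      (X = 1 ∨ X = Jtilde U ∨ ∃ ε : Sgn, X = Q U n m Δ Γ ε 0 0) ∧
      ∃ (μ ν : Sgn) (i s j t : ℕ),
        M = X * S U n Δ μ ^ i * S0 U n Δ ^ s * T U m Γ ν ^ j * T0 U m Γ ^ t} ∪
  {M | ∃ (ε ν : Sgn) (α i j t : ℕ), 1 ≤ α ∧ α ≤ Δ ∧
        M = Q U n m Δ Γ ε α 0 * S U n Δ ε.opp ^ i * T U m Γ ν ^ j * T0 U m Γ ^ t} ∪
  {M | ∃ (ε μ : Sgn) (β i s j : ℕ), 1 ≤ β ∧ β ≤ Γ ∧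
        M = Q U n m Δ Γ ε 0 β * S U n Δ μ ^ i * S0 U n Δ ^ s * T U m Γ ε ^ j} ∪
  {M | ∃ (ε : Sgn) (α β i j : ℕ), 1 ≤ α ∧ α ≤ Δ ∧ 1 ≤ β ∧ β ≤ Γ ∧
        M = Q U n m Δ Γ ε α β * S U n Δ ε.opp ^ i * T U m Γ ε ^ j}

end RectMod

end

/-!
Call `x ^ u ∂_x ^ a y ^ v ∂_y ^ b` admissible from `R_{N,M}` to `R_{N',M'}` if
`N ≤ N' + a`, `u + N ≤ N' + 2 a` and likewise for `(M, M', b, v)`. Let `T` be an operator of order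
`k` that maps `R_{N,M}` to `R_{N',M'}` and has only derivatives `∂_x ^ i ∂_y ^ j` with `i ≤ N`,
`j ≤ M`. Its coefficients are polynomials, and its part of a given weight multiplies each
`x ^ p y ^ q`, up to the shift of exponents, by a combination of products of falling factorials of
`p` and `q`. This combination vanishes whenever the shifted exponent leaves the target rectangle.
If the weight is that of a top-order term `x ^ u ∂_x ^ a y ^ v ∂_y ^ b` which is not admissible,
this happens for more than `a` values of `p` or for more than `b` values of `q`. As `a + b = k`, the
coefficient of the `b`-th falling factorial of `q` has degree at most `a` in `p`, and vice versa, so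
the coefficient of that term is zero.

Conversely, each admissible leading term is a product of one-variable leading terms: `J^±`, `J^0`
have leading terms `x ^ 2 ∂`, `∂`, `x ∂`, and multiplication by `x ^ α` or the operators `q̄_α` make
up for the difference of the degrees. Subtracting such products lowers the order of `T`. The matrix
case follows entry by entry, as `(1 ± J̃) / 2` are the diagonal matrix units.
-/

noncomputable section

namespace RectMod

section Wirtinger

variable {U : Dom}

theorem differentiableAt_ext0 (f : Smooth U) (p : U) : DifferentiableAt ℝ (ext0 U f.1) p :=
  (f.2.differentiableOn (by simp)).differentiableAt (U.isOpen.mem_nhds p.2)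

theorem fderiv_ext0 (f : Smooth U) {g : ℂ × ℂ → ℂ} (h : ∀ p : U, f.1 p = g p) (p : U) :
    fderiv ℝ (ext0 U f.1) p = fderiv ℝ g p :=
  (Filter.eventuallyEq_of_mem (U.isOpen.mem_nhds p.2) fun r hr =>
    (ext0_apply U f.1 ⟨r, hr⟩).trans (h ⟨r, hr⟩)).fderiv_eq

theorem wirtinger_apply (v : ℂ × ℂ) (f : Smooth U) (p : U) :
    (wirtinger U v f).1 p = (1 / 2 : ℂ) * (fderiv ℝ (ext0 U f.1) p v
      - Complex.I * fderiv ℝ (ext0 U f.1) p (Complex.I • v)) := rfl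

theorem wirtinger_mul (v : ℂ × ℂ) (f g : Smooth U) :
    wirtinger U v (f * g) = f * wirtinger U v g + g * wirtinger U v f := by
  ext p
  have product_rule : fderiv ℝ (ext0 U (f * g).1) p =
      f.1 p • fderiv ℝ (ext0 U g.1) p + g.1 p • fderiv ℝ (ext0 U f.1) p := by
    rw [fderiv_ext0 (f * g) (g := ext0 U f.1 * ext0 U g.1) (fun q => by
        simp only [Pi.mul_apply, ext0_apply, Subalgebra.coe_mul]),
      fderiv_mul (differentiableAt_ext0 f p) (differentiableAt_ext0 g p), ext0_apply, ext0_apply]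
  simp only [Subalgebra.coe_add, Subalgebra.coe_mul, Pi.add_apply, Pi.mul_apply, wirtinger_apply]
  rw [← Subalgebra.coe_mul, product_rule]
  simp only [add_apply, smul_apply, smul_eq_mul]
  ring

theorem wirtinger_of_eq_clm (v : ℂ × ℂ) {f : Smooth U} (ℓ : ℂ × ℂ →L[ℂ] ℂ)
    (h : ∀ p : U, f.1 p = ℓ p) : wirtinger U v f = algebraMap ℂ _ (ℓ v) := by
  ext p
  rw [wirtinger_apply, fderiv_ext0 f h,
    (ℓ.restrictScalars ℝ).hasFDerivAt.fderiv (x := (p : ℂ × ℂ)) (f := ℓ)]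
  simp only [ContinuousLinearMap.coe_restrictScalars', map_smul, smul_eq_mul, ← mul_assoc,
    Complex.I_mul_I]
  change _ = ℓ v
  ring

theorem wirtinger_x (v : ℂ × ℂ) : wirtinger U v (x U) = algebraMap ℂ _ v.1 :=
  wirtinger_of_eq_clm v (.fst ℂ ℂ ℂ) fun _ => rfl

theorem wirtinger_y (v : ℂ × ℂ) : wirtinger U v (y U) = algebraMap ℂ _ v.2 :=
  wirtinger_of_eq_clm v (.snd ℂ ℂ ℂ) fun _ => rfl

theorem fderiv_wirtinger (v w : ℂ × ℂ) (f : Smooth U) (p : U) :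
    fderiv ℝ (ext0 U (wirtinger U v f).1) p w =
      (1 / 2 : ℂ) * (fderiv ℝ (fderiv ℝ (ext0 U f.1)) p w v
        - Complex.I * fderiv ℝ (fderiv ℝ (ext0 U f.1)) p w (Complex.I • v)) := by
  have smooth_fderiv : ContDiffOn ℝ ∞ (fderiv ℝ (ext0 U f.1)) U :=
    ContDiffOn.fderiv_of_isOpen f.2 U.isOpen (by simp)
  have second_deriv : HasFDerivAt (fderiv ℝ (ext0 U f.1)) (fderiv ℝ (fderiv ℝ (ext0 U f.1)) p) p :=
    ((smooth_fderiv.differentiableOn (by simp)).differentiableAt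
      (U.isOpen.mem_nhds p.2)).hasFDerivAt
  have along (z : ℂ × ℂ) := second_deriv.clm_apply (hasFDerivAt_const z (p : ℂ × ℂ))
  rw [fderiv_ext0 (wirtinger U v f) (g := fun q => (1 / 2 : ℂ) * (fderiv ℝ (ext0 U f.1) q v
      - Complex.I * fderiv ℝ (ext0 U f.1) q (Complex.I • v))) (wirtinger_apply v f),
    (((along v).fun_sub ((along (Complex.I • v)).const_mul Complex.I)).const_mul
      (1 / 2 : ℂ)).fderiv]
  simp

theorem wirtinger_comm (v w : ℂ × ℂ) : Commute (wirtinger U v) (wirtinger U w) := by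
  ext f p
  have symm : IsSymmSndFDerivAt ℝ (ext0 U f.1) p :=
    (f.2.contDiffAt (U.isOpen.mem_nhds p.2)).isSymmSndFDerivAt (by
      simp only [minSmoothness_of_isRCLikeNormedField]; exact WithTop.coe_le_coe.2 le_top)
  rw [Module.End.mul_apply, Module.End.mul_apply, wirtinger_apply, wirtinger_apply]
  simp only [fderiv_wirtinger]
  rw [symm w v, symm w (Complex.I • v), symm (Complex.I • w) v,
    symm (Complex.I • w) (Complex.I • v)]
  ring

/-- The complex derivative along `v`, as a derivation of the algebra of smooth functions. -/
def wirtingerDer (U : Dom) (v : ℂ × ℂ) : Derivation ℂ (Smooth U) (Smooth U) :=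
  Derivation.mk' (wirtinger U v) (wirtinger_mul v)

theorem wirtinger_pow (v : ℂ × ℂ) (f : Smooth U) (n : ℕ) :
    wirtinger U v (f ^ n) = n • f ^ (n - 1) • wirtinger U v f :=
  (wirtingerDer U v).leibniz_pow f n

theorem dx_monomial (p q : ℕ) :
    dx U (x U ^ p * y U ^ q) = (p : ℂ) • (x U ^ (p - 1) * y U ^ q) := by
  rw [dx, wirtinger_mul, wirtinger_pow, wirtinger_pow, wirtinger_x, wirtinger_y]
  simp only [map_one, map_zero, smul_zero, mul_zero, zero_add, smul_eq_mul, mul_one,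
    Nat.cast_smul_eq_nsmul, smul_mul_assoc, mul_comm (y U ^ q)]

theorem dy_monomial (p q : ℕ) :
    dy U (x U ^ p * y U ^ q) = (q : ℂ) • (x U ^ p * y U ^ (q - 1)) := by
  rw [dy, wirtinger_mul, wirtinger_pow, wirtinger_pow, wirtinger_x, wirtinger_y]
  simp only [map_one, map_zero, smul_zero, mul_zero, add_zero, smul_eq_mul, mul_one,
    Nat.cast_smul_eq_nsmul, mul_smul_comm]

end Wirtinger

theorem pow_apply_eq_descFactorial_smul {R V : Type*} [CommSemiring R] [AddCommMonoid V]
    [Module R V] {D : Module.End R V} {e : ℕ → V} (hD : ∀ p, D (e p) = (p : R) • e (p - 1))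
    (i p : ℕ) : (D ^ i) (e p) = (p.descFactorial i : R) • e (p - i) := by
  induction i with
  | zero => simp
  | succ i ih =>
    rw [pow_succ', Module.End.mul_apply, ih, map_smul, hD, smul_smul, Nat.descFactorial_succ,
      mul_comm, Nat.sub_sub, Nat.cast_mul]

theorem dx_pow_dy_pow_monomial {U : Dom} (i j p q : ℕ) :
    (dx U ^ i * dy U ^ j) (x U ^ p * y U ^ q) =
      ((p.descFactorial i * q.descFactorial j : ℕ) : ℂ) • (x U ^ (p - i) * y U ^ (q - j)) := by
  rw [Module.End.mul_apply, pow_apply_eq_descFactorial_smul (e := fun q => x U ^ p * y U ^ q)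
      (dy_monomial p), map_smul, pow_apply_eq_descFactorial_smul
      (e := fun p => x U ^ p * y U ^ (q - j)) (dx_monomial · (q - j)), smul_smul, mul_comm,
    Nat.cast_mul]

section WeylRelations

variable {U : Dom}

theorem mulOp_eq_lmul (f : Smooth U) : mulOp U f = Algebra.lmul ℂ (Smooth U) f := rfl

theorem mulOp_mul (f g : Smooth U) : mulOp U (f * g) = mulOp U f * mulOp U g :=
  map_mul (Algebra.lmul ℂ (Smooth U)) f g

theorem mulOp_pow (f : Smooth U) (n : ℕ) : mulOp U (f ^ n) = mulOp U f ^ n :=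
  map_pow (Algebra.lmul ℂ (Smooth U)) f n

theorem wirtinger_mul_mulOp (v : ℂ × ℂ) (f : Smooth U) :
    wirtinger U v * mulOp U f = mulOp U f * wirtinger U v + mulOp U (wirtinger U v f) :=
  LinearMap.ext fun g => (wirtinger_mul v f g).trans (congrArg _ (mul_comm _ _))

theorem dx_mul_mulOp_x : dx U * mulOp U (x U) = mulOp U (x U) * dx U + 1 := by
  rw [dx, wirtinger_mul_mulOp, wirtinger_x, mulOp_eq_lmul (algebraMap _ _ _), map_one, map_one]

theorem dy_mul_mulOp_y : dy U * mulOp U (y U) = mulOp U (y U) * dy U + 1 := by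
  rw [dy, wirtinger_mul_mulOp, wirtinger_y, mulOp_eq_lmul (algebraMap _ _ _), map_one, map_one]

theorem commute_dx_mulOp_y : Commute (dx U) (mulOp U (y U)) := by
  rw [commute_iff_eq, dx, wirtinger_mul_mulOp, wirtinger_y, mulOp_eq_lmul (algebraMap _ _ _),
    map_zero, map_zero, add_zero]

theorem commute_dy_mulOp_x : Commute (dy U) (mulOp U (x U)) := by
  rw [commute_iff_eq, dy, wirtinger_mul_mulOp, wirtinger_x, mulOp_eq_lmul (algebraMap _ _ _),
    map_zero, map_zero, add_zero]

theorem commute_mulOp (f g : Smooth U) : Commute (mulOp U f) (mulOp U g) :=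
  (Commute.all f g).map (Algebra.lmul ℂ (Smooth U))

end WeylRelations

section Weyl

variable {R A : Type*} [CommRing R] [Ring A] [Algebra R A]

variable (R) in
/-- The operators of order less than `a` in normally ordered form: the span of the `X ^ u * D ^ i`
with `i < a`. It is used for `X`, `D` subject to the Weyl relation `D * X = X * D + 1`. -/
def ordLT (X D : A) (a : ℕ) : Submodule R A :=
  Submodule.span R {P | ∃ u i : ℕ, i < a ∧ P = X ^ u * D ^ i}

variable (R) in
/-- `P` has order `a` with leading term `X ^ u * D ^ a`. -/
def HasLead (X D P : A) (u a : ℕ) : Prop := P - X ^ u * D ^ a ∈ ordLT R X D a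

variable {X D P P' : A} {a b u v : ℕ}

theorem pow_mul_pow_mem_ordLT (u : ℕ) (h : b < a) : X ^ u * D ^ b ∈ ordLT R X D a :=
  Submodule.subset_span ⟨u, b, h, rfl⟩

theorem ordLT_mono (h : a ≤ b) : ordLT R X D a ≤ ordLT R X D b :=
  Submodule.span_mono fun _ ⟨u, i, hi, hP⟩ => ⟨u, i, hi.trans_le h, hP⟩

theorem pow_mul_mem_ordLT (v : ℕ) (hP : P ∈ ordLT R X D a) : X ^ v * P ∈ ordLT R X D a := by
  suffices ordLT R X D a ≤ (ordLT R X D a).comap (LinearMap.mulLeft R (X ^ v)) from this hP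
  refine Submodule.span_le.2 ?_
  rintro _ ⟨u, i, hi, rfl⟩
  rw [SetLike.mem_coe, Submodule.mem_comap, LinearMap.mulLeft_apply, ← mul_assoc, ← pow_add]
  exact pow_mul_pow_mem_ordLT _ hi

theorem mul_pow_mem_ordLT (b : ℕ) (hP : P ∈ ordLT R X D a) : P * D ^ b ∈ ordLT R X D (a + b) := by
  suffices ordLT R X D a ≤ (ordLT R X D (a + b)).comap (LinearMap.mulRight R (D ^ b)) from this hP
  refine Submodule.span_le.2 ?_
  rintro _ ⟨u, i, hi, rfl⟩
  rw [SetLike.mem_coe, Submodule.mem_comap, LinearMap.mulRight_apply, mul_assoc, ← pow_add]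
  exact pow_mul_pow_mem_ordLT _ (by lia)

theorem HasLead.mem_ordLT (hP : HasLead R X D P u a) : P ∈ ordLT R X D (a + 1) := by
  rw [← sub_add_cancel P (X ^ u * D ^ a)]
  exact add_mem (ordLT_mono a.le_succ hP) (pow_mul_pow_mem_ordLT u a.lt_succ_self)

theorem hasLead_pow_left (u : ℕ) : HasLead R X D (X ^ u) u 0 := by simp [HasLead]

theorem hasLead_pow_right (a : ℕ) : HasLead R X D (D ^ a) 0 a := by simp [HasLead]

theorem hasLead_one : HasLead R X D 1 0 0 := by simp [HasLead]

section WeylRelation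

variable (h : D * X = X * D + 1)
include h

theorem deriv_mul_pow (u : ℕ) : D * X ^ u = X ^ u * D + u • X ^ (u - 1) := by
  induction u with
  | zero => simp
  | succ u ih =>
    rcases u with _ | u
    · simpa using h
    · rw [pow_succ, ← mul_assoc, ih, add_mul, mul_assoc, h, smul_mul_assoc, Nat.add_sub_cancel,
        Nat.add_sub_cancel, ← pow_succ, succ_nsmul _ (u + 1), mul_add, mul_one, ← mul_assoc]
      abel

theorem deriv_mul_mem_ordLT (hP : P ∈ ordLT R X D a) : D * P ∈ ordLT R X D (a + 1) := by
  suffices ordLT R X D a ≤ (ordLT R X D (a + 1)).comap (LinearMap.mulLeft R D) from this hP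
  refine Submodule.span_le.2 ?_
  rintro _ ⟨u, i, hi, rfl⟩
  rw [SetLike.mem_coe, Submodule.mem_comap, LinearMap.mulLeft_apply, ← mul_assoc, deriv_mul_pow h,
    add_mul, mul_assoc, ← pow_succ', smul_mul_assoc]
  exact add_mem (pow_mul_pow_mem_ordLT _ (by lia))
    (nsmul_mem (pow_mul_pow_mem_ordLT _ (by lia)) _)

theorem hasLead_deriv_pow_mul_pow (a v : ℕ) : HasLead R X D (D ^ a * X ^ v) v a := by
  induction a with
  | zero => simpa using hasLead_pow_left v
  | succ a ih =>
    have split : D ^ (a + 1) * X ^ v - X ^ v * D ^ (a + 1) =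
        D * (D ^ a * X ^ v - X ^ v * D ^ a) + v • (X ^ (v - 1) * D ^ a) := by
      rw [← smul_mul_assoc, ← sub_eq_of_eq_add' (deriv_mul_pow h v), pow_succ']
      noncomm_ring
    rw [HasLead, split]
    exact add_mem (deriv_mul_mem_ordLT h ih) (nsmul_mem (pow_mul_pow_mem_ordLT _ a.lt_succ_self) _)

theorem hasLead_monomial_mul_monomial (u a v b : ℕ) :
    HasLead R X D (X ^ u * D ^ a * (X ^ v * D ^ b)) (u + v) (a + b) := by
  have factor : X ^ u * D ^ a * (X ^ v * D ^ b) - X ^ (u + v) * D ^ (a + b) =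
      X ^ u * ((D ^ a * X ^ v - X ^ v * D ^ a) * D ^ b) := by
    rw [pow_add, pow_add]
    noncomm_ring
  rw [HasLead, factor]
  exact pow_mul_mem_ordLT u (mul_pow_mem_ordLT b (hasLead_deriv_pow_mul_pow h a v))

theorem mul_mem_ordLT (hP : P ∈ ordLT R X D a) (hP' : P' ∈ ordLT R X D b) :
    P * P' ∈ ordLT R X D (a + b - 1) := by
  suffices ordLT R X D a * ordLT R X D b ≤ ordLT R X D (a + b - 1) from
    this (Submodule.mul_mem_mul hP hP')
  rw [ordLT, ordLT, Submodule.span_mul_span, Submodule.span_le]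
  rintro _ ⟨_, ⟨u, i, hi, rfl⟩, _, ⟨v, j, hj, rfl⟩, rfl⟩
  exact ordLT_mono (by lia) (hasLead_monomial_mul_monomial h u i v j).mem_ordLT

theorem HasLead.mul (hP : HasLead R X D P u a) (hP' : HasLead R X D P' v b) :
    HasLead R X D (P * P') (u + v) (a + b) := by
  have telescope : P * P' - X ^ (u + v) * D ^ (a + b) =
      (P - X ^ u * D ^ a) * P' + X ^ u * D ^ a * (P' - X ^ v * D ^ b) +
        (X ^ u * D ^ a * (X ^ v * D ^ b) - X ^ (u + v) * D ^ (a + b)) := by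
    noncomm_ring
  rw [HasLead, telescope]
  refine add_mem (add_mem ?_ ?_) (hasLead_monomial_mul_monomial h u a v b)
  · exact ordLT_mono (by lia) (mul_mem_ordLT h hP hP'.mem_ordLT)
  · exact ordLT_mono (by lia) (mul_mem_ordLT h (pow_mul_pow_mem_ordLT u a.lt_succ_self) hP')

theorem HasLead.pow (hP : HasLead R X D P u a) (n : ℕ) :
    HasLead R X D (P ^ n) (n * u) (n * a) := by
  induction n with
  | zero => simpa using hasLead_one
  | succ n ih => simpa only [pow_succ, Nat.succ_mul] using ih.mul h hP

theorem hasLead_list_prod (l : List A) (hl : ∀ P ∈ l, HasLead R X D P 1 1) :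
    HasLead R X D l.prod l.length l.length := by
  induction l with
  | nil => exact hasLead_one
  | cons P l ih =>
    rw [List.prod_cons, List.length_cons, add_comm]
    exact (hl P List.mem_cons_self).mul h (ih fun Q hQ => hl Q (List.mem_cons_of_mem _ hQ))

end WeylRelation

theorem hasLead_euler (c : R) : HasLead R X D (X * D - algebraMap R A c) 1 1 := by
  rw [HasLead, pow_one, pow_one, sub_sub_cancel_left, Algebra.algebraMap_eq_smul_one]
  simpa using neg_mem (Submodule.smul_mem (ordLT R X D 1) c (pow_mul_pow_mem_ordLT 0 one_pos))

end Weyl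

section SlTwoLead

variable {A : Type*} [Ring A] [Algebra ℂ A] {X D : A}

theorem hasLead_slZero (c : ℂ) : HasLead ℂ X D (slZero X D c) 1 1 := hasLead_euler _

theorem hasLead_slPM_plus (c : ℂ) : HasLead ℂ X D (slPM X D c .plus) 2 1 := by
  rw [HasLead, slPM, pow_one, sub_sub_cancel_left]
  simpa using neg_mem (Submodule.smul_mem (ordLT ℂ X D 1) c (pow_mul_pow_mem_ordLT 1 one_pos))

theorem hasLead_slPM_minus (c : ℂ) : HasLead ℂ X D (slPM X D c .minus) 0 1 := by
  simp [HasLead, slPM]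

theorem slPM_pow_mul_slZero_pow_mem_ordLT (h : D * X = X * D + 1) (c : ℂ) (μ : Sgn) (i s : ℕ) :
    slPM X D c μ ^ i * slZero X D c ^ s ∈ ordLT ℂ X D (i + s + 1) := by
  obtain ⟨v, lead⟩ : ∃ v, HasLead ℂ X D (slPM X D c μ) v 1 := by
    cases μ with
    | plus => exact ⟨2, hasLead_slPM_plus c⟩
    | minus => exact ⟨0, hasLead_slPM_minus c⟩
  simpa only [mul_one] using ((lead.pow h i).mul h ((hasLead_slZero c).pow h s)).mem_ordLT

theorem qbar_eq (n Δ α : ℕ) : qbar X D n Δ α = ((List.range (Δ - α)).map fun k : ℕ =>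
    X * D - algebraMap ℂ A ((n : ℂ) - Δ + ((k : ℂ) + 1))).prod * D ^ α := by
  simp [qbar, Function.comp_def, ← List.map_eq_flatMap]

theorem hasLead_qbar (h : D * X = X * D + 1) (n : ℕ) {Δ α : ℕ} (hα : α ≤ Δ) :
    HasLead ℂ X D (qbar X D n Δ α) (Δ - α) Δ := by
  have product_lead := hasLead_list_prod (R := ℂ) h ((List.range (Δ - α)).map fun k : ℕ =>
    X * D - algebraMap ℂ A ((n : ℂ) - Δ + ((k : ℂ) + 1))) (fun P hP => by
      obtain ⟨k, _, rfl⟩ := List.mem_map.1 hP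
      exact hasLead_euler _)
  rw [List.length_map, List.length_range] at product_lead
  rw [qbar_eq]
  simpa only [add_zero, Nat.sub_add_cancel hα] using product_lead.mul h (hasLead_pow_right α)

end SlTwoLead

section Ladder

variable {V ι : Type*} [AddCommGroup V] [Module ℂ V]

/-- The span of the first `N + 1` vectors of each of the strings `e j`, `j ∈ s`. -/
def ladder (e : ι → ℕ → V) (s : Set ι) (N : ℕ) : Submodule ℂ V :=
  Submodule.span ℂ {v | ∃ j ∈ s, ∃ p ≤ N, v = e j p}

/-- `X` and `D` act on each string `e j` as multiplication by the variable and differentiation act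
on the powers of the variable. -/
structure IsLadder (e : ι → ℕ → V) (X D : Module.End ℂ V) : Prop where
  raise (j : ι) (p : ℕ) : X (e j p) = e j (p + 1)
  lower (j : ι) (p : ℕ) : D (e j p) = (p : ℂ) • e j (p - 1)

/-- `P` maps the ladders of length `N` over `e` to the ladders of length `N'`. -/
def MapsLadder (e : ι → ℕ → V) (P : Module.End ℂ V) (N N' : ℕ) : Prop :=
  ∀ s, ladder e s N ≤ (ladder e s N').comap P

variable {e : ι → ℕ → V} {s : Set ι} {X D P P' : Module.End ℂ V} {N N' N'' : ℕ}

theorem mem_ladder {j : ι} {p : ℕ} (hj : j ∈ s) (hp : p ≤ N) : e j p ∈ ladder e s N :=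
  Submodule.subset_span ⟨j, hj, p, hp, rfl⟩

theorem ladder_mono (h : N ≤ N') : ladder e s N ≤ ladder e s N' :=
  Submodule.span_mono fun _ ⟨j, hj, p, hp, hv⟩ => ⟨j, hj, p, hp.trans h, hv⟩

namespace MapsLadder

theorem of_apply_mem (h : ∀ s, ∀ j ∈ s, ∀ p ≤ N, P (e j p) ∈ ladder e s N') :
    MapsLadder e P N N' := fun s => by
  refine Submodule.span_le.2 ?_
  rintro _ ⟨j, hj, p, hp, rfl⟩
  exact h s j hj p hp

theorem mono_right (hP : MapsLadder e P N N') (h : N' ≤ N'') : MapsLadder e P N N'' :=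
  fun s => (hP s).trans (Submodule.comap_mono (ladder_mono h))

theorem one : MapsLadder e 1 N N := fun _ => le_rfl

theorem mul (hP : MapsLadder e P N' N'') (hP' : MapsLadder e P' N N') :
    MapsLadder e (P * P') N N'' := fun s _ hv => hP s (hP' s hv)

theorem pow (hP : MapsLadder e P N N) (i : ℕ) : MapsLadder e (P ^ i) N N := by
  induction i with
  | zero => exact one
  | succ i ih => rw [pow_succ]; exact ih.mul hP

end MapsLadder

namespace IsLadder

variable (he : IsLadder e X D)
include he

theorem mapsLadder_raise_pow (N u : ℕ) : MapsLadder e (X ^ u) N (N + u) := by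
  induction u with
  | zero => exact .one
  | succ u ih =>
    rw [pow_succ']
    refine .mul (.of_apply_mem fun s j hj p hp => ?_) ih
    rw [he.raise]
    exact mem_ladder hj (Nat.succ_le_succ hp)

theorem mapsLadder_lower_pow (N a : ℕ) : MapsLadder e (D ^ a) N (N - a) :=
  .of_apply_mem fun s j hj p hp => by
    rw [pow_apply_eq_descFactorial_smul (he.lower j)]
    exact Submodule.smul_mem _ _ (mem_ladder hj (Nat.sub_le_sub_right hp a))

theorem euler_apply (j : ι) (p : ℕ) : (X * D) (e j p) = (p : ℂ) • e j p := by
  rw [Module.End.mul_apply, he.lower, map_smul, he.raise]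
  rcases p with _ | p
  · simp
  · rfl

theorem euler_sub_apply (c : ℂ) (j : ι) (p : ℕ) :
    (X * D - algebraMap ℂ (Module.End ℂ V) c) (e j p) = ((p : ℂ) - c) • e j p := by
  rw [LinearMap.sub_apply, he.euler_apply, Module.algebraMap_end_apply, sub_smul]

theorem mapsLadder_slZero (N : ℕ) (c : ℂ) : MapsLadder e (slZero X D c) N N :=
  .of_apply_mem fun s j hj p hp => by
    rw [slZero, he.euler_sub_apply]
    exact Submodule.smul_mem _ _ (mem_ladder hj hp)

theorem slPM_plus_apply (c : ℂ) (j : ι) (p : ℕ) :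
    slPM X D c .plus (e j p) = ((p : ℂ) - c) • e j (p + 1) := by
  rw [slPM, LinearMap.sub_apply, LinearMap.smul_apply, he.raise, pow_two, mul_assoc,
    Module.End.mul_apply, he.euler_apply, map_smul, he.raise, sub_smul]

theorem mapsLadder_slPM (N : ℕ) (ε : Sgn) : MapsLadder e (slPM X D (N : ℂ) ε) N N := by
  cases ε with
  | minus =>
    simpa only [pow_one, slPM] using (he.mapsLadder_lower_pow N 1).mono_right (Nat.sub_le N 1)
  | plus =>
    refine .of_apply_mem fun s j hj p hp => ?_
    rw [he.slPM_plus_apply]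
    rcases hp.eq_or_lt with rfl | hp
    · rw [sub_self, zero_smul]
      exact zero_mem _
    · exact Submodule.smul_mem _ _ (mem_ladder hj hp)

theorem mapsLadder_euler_sub (N : ℕ) :
    MapsLadder e (X * D - algebraMap ℂ (Module.End ℂ V) (N + 1)) (N + 1) N :=
  .of_apply_mem fun s j hj p hp => by
    rw [he.euler_sub_apply]
    rcases hp.eq_or_lt with rfl | hp
    · rw [Nat.cast_succ, sub_self, zero_smul]
      exact zero_mem _
    · exact Submodule.smul_mem _ _ (mem_ladder hj (Nat.lt_succ_iff.1 hp))

theorem mapsLadder_qbar {n Δ α : ℕ} (hΔ : Δ ≤ n) (hα : α ≤ Δ) :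
    MapsLadder e (qbar X D n Δ α) n (n - Δ) := by
  have maps_prod (r : ℕ) : MapsLadder e ((List.range r).map fun k : ℕ =>
      X * D - algebraMap ℂ (Module.End ℂ V) ((n : ℂ) - Δ + ((k : ℂ) + 1))).prod
      (n - Δ + r) (n - Δ) := by
    induction r with
    | zero => exact .one
    | succ r ih =>
      have maps_last := he.mapsLadder_euler_sub (n - Δ + r)
      rw [Nat.cast_add, Nat.cast_sub hΔ, add_assoc] at maps_last
      rw [List.range_succ, List.map_append, List.prod_append, List.map_singleton,
        List.prod_singleton]
      exact ih.mul maps_last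
  have maps_deriv := he.mapsLadder_lower_pow n α
  rw [show n - α = n - Δ + (Δ - α) by lia] at maps_deriv
  rw [qbar_eq]
  exact (maps_prod _).mul maps_deriv

end IsLadder

end Ladder

section AdaptedFamilies

/-- The pairs `(a, u)` for which an operator of order `a` that maps polynomials of degree at most
`N` to polynomials of degree at most `N'` can have leading term `x ^ u ∂ ^ a`. -/
def Admissible (N N' a u : ℕ) : Prop := N ≤ N' + a ∧ u + N ≤ N' + 2 * a

/-- The monomials `(J^±)^i (J^0)^s`, `i + s = a`, in the `sl₂` operators with parameter `c`. -/
def slMonomials {A : Type*} [Ring A] [Algebra ℂ A] (X D : A) (c : ℂ) (a : ℕ) : Set A :=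
  {P | ∃ (μ : Sgn) (i s : ℕ), i + s = a ∧ P = slPM X D c μ ^ i * slZero X D c ^ s}

/-- The one-variable factors of the off-diagonal monomials: `L 0` times any `sl₂` monomial, or one
of `L 1, …, L Δ` times a power of the single operator `J^σ`. Here `L α` is `X ^ α` or `q̄_α`. -/
def qFactors {A : Type*} [Ring A] [Algebra ℂ A] (X D : A) (c : ℂ) (σ : Sgn) (L : ℕ → A) (Δ : ℕ) :
    Set A :=
  {P | ∃ a, ∃ M ∈ slMonomials X D c a, P = L 0 * M} ∪
    {P | ∃ α i : ℕ, 1 ≤ α ∧ α ≤ Δ ∧ P = L α * slPM X D c σ ^ i}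

variable {V ι : Type*} [AddCommGroup V] [Module ℂ V]

/-- Every admissible leading term of order `a` is realized by an operator in `B a` that maps the
ladders of length `N` to those of length `N'`. -/
def IsAdapted (e : ι → ℕ → V) (X D : Module.End ℂ V) (N N' : ℕ) (B : ℕ → Set (Module.End ℂ V)) :
    Prop :=
  ∀ a u, Admissible N N' a u → ∃ P ∈ B a, HasLead ℂ X D P u a ∧ MapsLadder e P N N'

variable {e : ι → ℕ → V} {X D : Module.End ℂ V} (he : IsLadder e X D) (h : D * X = X * D + 1)
include he h

theorem isAdapted_slMonomials (N : ℕ) : IsAdapted e X D N N (slMonomials X D N) := by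
  intro a u hau
  have maps (μ : Sgn) (i s : ℕ) :
      MapsLadder e (slPM X D (N : ℂ) μ ^ i * slZero X D (N : ℂ) ^ s) N N :=
    ((he.mapsLadder_slPM N μ).pow i).mul ((he.mapsLadder_slZero N N).pow s)
  have hu : u ≤ 2 * a := by have := hau.2; lia
  rcases le_total a u with hle | hle
  · refine ⟨_, ⟨.plus, u - a, 2 * a - u, by lia, rfl⟩, ?_, maps _ _ _⟩
    convert ((hasLead_slPM_plus (N : ℂ)).pow h (u - a)).mul h
      ((hasLead_slZero (N : ℂ)).pow h (2 * a - u)) using 1 <;> lia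
  · refine ⟨_, ⟨.minus, a - u, u, by lia, rfl⟩, ?_, maps _ _ _⟩
    convert ((hasLead_slPM_minus (N : ℂ)).pow h (a - u)).mul h
      ((hasLead_slZero (N : ℂ)).pow h u) using 1 <;> lia

theorem isAdapted_raising (N Δ : ℕ) :
    IsAdapted e X D N (N + Δ) fun _ => qFactors X D N .plus (X ^ ·) Δ := by
  intro a u hau
  have hu : u ≤ 2 * a + Δ := by have := hau.2; lia
  rcases le_or_gt u (2 * a) with hle | hlt
  · obtain ⟨M, hM, lead, maps⟩ := isAdapted_slMonomials he h N a u ⟨by lia, by lia⟩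
    refine ⟨X ^ 0 * M, .inl ⟨_, M, hM, rfl⟩, by simpa using lead, ?_⟩
    rw [pow_zero, one_mul]
    exact maps.mono_right (Nat.le_add_right N Δ)
  · refine ⟨_, .inr ⟨u - 2 * a, a, by lia, by lia, rfl⟩, ?_, ?_⟩
    · convert (hasLead_pow_left (u - 2 * a)).mul h ((hasLead_slPM_plus (N : ℂ)).pow h a) using 1 <;>
        lia
    · exact ((he.mapsLadder_raise_pow N _).mono_right (by lia)).mul
        ((he.mapsLadder_slPM N .plus).pow a)

theorem isAdapted_lowering {n Δ : ℕ} (hΔ : Δ ≤ n) :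
    IsAdapted e X D n (n - Δ) fun _ => qFactors X D n .minus (qbar X D n Δ) Δ := by
  rintro a u ⟨ha, hu⟩
  rcases le_or_gt Δ u with hle | hlt
  · obtain ⟨M, hM, lead, maps⟩ := isAdapted_slMonomials he h n (a - Δ) (u - Δ) ⟨by lia, by lia⟩
    refine ⟨_, .inl ⟨_, M, hM, rfl⟩, ?_, (he.mapsLadder_qbar hΔ Δ.zero_le).mul maps⟩
    convert (hasLead_qbar h n Δ.zero_le).mul h lead using 1 <;> lia
  · refine ⟨_, .inr ⟨Δ - u, a - Δ, by lia, by lia, rfl⟩, ?_,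
      (he.mapsLadder_qbar hΔ (Nat.sub_le Δ u)).mul ((he.mapsLadder_slPM n .minus).pow _)⟩
    convert (hasLead_qbar h n (Nat.sub_le Δ u)).mul h
      ((hasLead_slPM_minus (n : ℂ)).pow h (a - Δ)) using 1 <;> lia

end AdaptedFamilies

section Rectangles

variable {U : Dom}

theorem isLadder_x : IsLadder (fun j i => x U ^ i * y U ^ j) (mulOp U (x U)) (dx U) where
  raise j p := by rw [mulOp, LinearMap.mulLeft_apply, ← mul_assoc, ← pow_succ']
  lower j p := dx_monomial p j

theorem isLadder_y : IsLadder (fun i j => x U ^ i * y U ^ j) (mulOp U (y U)) (dy U) where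
  raise i p := by rw [mulOp, LinearMap.mulLeft_apply, mul_left_comm, ← pow_succ']
  lower i p := dy_monomial i p

theorem rect_eq_ladder_x (N M : ℕ) :
    rect U N M = ladder (fun j i => x U ^ i * y U ^ j) (Set.Iic M) N := by
  refine congrArg _ (Set.ext fun f => ⟨?_, ?_⟩)
  · rintro ⟨i, j, hi, hj, rfl⟩
    exact ⟨j, hj, i, hi, rfl⟩
  · rintro ⟨j, hj, i, hi, rfl⟩
    exact ⟨i, j, hi, hj, rfl⟩

theorem rect_eq_ladder_y (N M : ℕ) :
    rect U N M = ladder (fun i j => x U ^ i * y U ^ j) (Set.Iic N) M := by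
  refine congrArg _ (Set.ext fun f => ⟨?_, ?_⟩)
  · rintro ⟨i, j, hi, hj, rfl⟩
    exact ⟨i, hi, j, hj, rfl⟩
  · rintro ⟨i, hi, j, hj, rfl⟩
    exact ⟨i, j, hi, hj, rfl⟩

end Rectangles

section Monomials

/-- The monomial `x ^ p.1 * y ^ p.2`. -/
def mon (U : Dom) (p : ℕ × ℕ) : Smooth U := x U ^ p.1 * y U ^ p.2

/-- The span of the monomials with exponents in `S`. -/
def monSpan (U : Dom) (S : Set (ℕ × ℕ)) : Submodule ℂ (Smooth U) := Submodule.span ℂ (mon U '' S)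

variable {U : Dom}

theorem mon_add (p q : ℕ × ℕ) : mon U (p + q) = mon U p * mon U q := by
  rw [mon, Prod.fst_add, Prod.snd_add, pow_add, pow_add, mul_mul_mul_comm, mon, mon]

theorem mon_mem_monSpan {S : Set (ℕ × ℕ)} {p : ℕ × ℕ} (hp : p ∈ S) : mon U p ∈ monSpan U S :=
  Submodule.subset_span ⟨p, hp, rfl⟩

theorem rect_eq_monSpan (N M : ℕ) : rect U N M = monSpan U (Set.Iic (N, M)) := by
  refine congrArg _ (Set.ext fun f => ⟨?_, ?_⟩)
  · rintro ⟨i, j, hi, hj, rfl⟩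
    exact ⟨(i, j), ⟨hi, hj⟩, rfl⟩
  · rintro ⟨p, ⟨hi, hj⟩, rfl⟩
    exact ⟨p.1, p.2, hi, hj, rfl⟩

theorem mon_mem_rect {N M : ℕ} {p : ℕ × ℕ} (hp : p ≤ (N, M)) : mon U p ∈ rect U N M := by
  rw [rect_eq_monSpan]
  exact mon_mem_monSpan hp

theorem mon_mul_mem_monSpan {S : Set (ℕ × ℕ)} {f : Smooth U} (r : ℕ × ℕ) (hf : f ∈ monSpan U S) :
    mon U r * f ∈ monSpan U ((r + ·) '' S) := by
  suffices monSpan U S ≤ (monSpan U ((r + ·) '' S)).comap (LinearMap.mulLeft ℂ (mon U r)) from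
    this hf
  refine Submodule.span_le.2 ?_
  rintro _ ⟨p, hp, rfl⟩
  rw [SetLike.mem_coe, Submodule.mem_comap, LinearMap.mulLeft_apply, ← mon_add]
  exact mon_mem_monSpan ⟨p, hp, rfl⟩

theorem mon_ne_zero [Nonempty U] (p : ℕ × ℕ) : mon U p ≠ 0 := by
  obtain ⟨⟨z, hz⟩⟩ := ‹Nonempty U›
  obtain ⟨s, hs, t, ht, hst⟩ := mem_nhds_prod_iff.1 (U.isOpen.mem_nhds hz)
  obtain ⟨a, ha, ha0⟩ := (infinite_of_mem_nhds _ hs).exists_notMem_finite (Set.finite_singleton 0)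
  obtain ⟨b, hb, hb0⟩ := (infinite_of_mem_nhds _ ht).exists_notMem_finite (Set.finite_singleton 0)
  intro h
  have vanish : a ^ p.1 * b ^ p.2 = 0 :=
    congrArg (fun f : Smooth U => f.1 ⟨(a, b), hst ⟨ha, hb⟩⟩) h
  exact mul_ne_zero (pow_ne_zero _ ha0) (pow_ne_zero _ hb0) vanish

/-- The monomials are eigenvectors of `x ∂_x + i y ∂_y` with the distinct eigenvalues `p + i q`. -/
theorem linearIndependent_mon [Nonempty U] : LinearIndependent ℂ (mon U) := by
  refine Module.End.eigenvectors_linearIndependent'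
    (mulOp U (x U) * dx U + Complex.I • (mulOp U (y U) * dy U))
    (fun p : ℕ × ℕ => (p.1 : ℂ) + Complex.I * p.2) (fun p q h => ?_) _ fun p =>
    ⟨Module.End.mem_eigenspace_iff.2 ?_, mon_ne_zero p⟩
  · exact Prod.ext (by simpa using congrArg Complex.re h) (by simpa using congrArg Complex.im h)
  · rw [LinearMap.add_apply, LinearMap.smul_apply, add_smul, mul_smul]
    exact congrArg₂ _ (isLadder_x.euler_apply p.2 p.1)
      (congrArg _ (isLadder_y.euler_apply p.1 p.2))

theorem exists_monomial_coefficients [Nonempty U] :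
    ∃ c : Smooth U →ₗ[ℂ] (ℕ × ℕ →₀ ℂ), ∀ p, c (mon U p) = Finsupp.single p 1 := by
  obtain ⟨c, hc⟩ := LinearMap.exists_leftInverse_of_injective
    (Finsupp.linearCombination ℂ (mon U))
    (LinearMap.ker_eq_bot.2 linearIndependent_mon.finsuppLinearCombination_injective)
  exact ⟨c, fun p => by simpa using LinearMap.congr_fun hc (Finsupp.single p 1)⟩

/-- A linear map that sends a polynomial to its coefficients; on other smooth functions its values
are arbitrary. -/
def monCoeff (U : Dom) [Nonempty U] : Smooth U →ₗ[ℂ] (ℕ × ℕ →₀ ℂ) :=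
  exists_monomial_coefficients.choose

variable [Nonempty U]

theorem monCoeff_mon (p : ℕ × ℕ) : monCoeff U (mon U p) = Finsupp.single p 1 :=
  exists_monomial_coefficients.choose_spec p

theorem monCoeff_linearCombination (l : ℕ × ℕ →₀ ℂ) :
    monCoeff U (Finsupp.linearCombination ℂ (mon U) l) = l := by
  induction l using Finsupp.induction_linear with
  | zero => simp
  | add l l' hl hl' => rw [map_add, map_add, hl, hl']
  | single p c => simp [monCoeff_mon]

theorem mem_monSpan_iff {S : Set (ℕ × ℕ)} {f : Smooth U} :
    f ∈ monSpan U S ↔ f ∈ monSpan U Set.univ ∧ ∀ p, monCoeff U f p ≠ 0 → p ∈ S := by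
  refine ⟨fun hf => ⟨Submodule.span_mono (Set.image_mono S.subset_univ) hf, ?_⟩, ?_⟩
  · obtain ⟨l, hl, rfl⟩ := (Finsupp.mem_span_image_iff_linearCombination ℂ).1 hf
    rw [monCoeff_linearCombination]
    exact fun p hp => hl (Finsupp.mem_support_iff.2 hp)
  · rintro ⟨hf, hS⟩
    obtain ⟨l, -, rfl⟩ := (Finsupp.mem_span_image_iff_linearCombination ℂ).1 hf
    rw [monCoeff_linearCombination] at hS
    exact (Finsupp.mem_span_image_iff_linearCombination ℂ).2
      ⟨l, fun p hp => hS p (Finsupp.mem_support_iff.1 hp), rfl⟩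

theorem monCoeff_mon_mul {f : Smooth U} (hf : f ∈ monSpan U Set.univ) (r k : ℕ × ℕ) :
    monCoeff U (mon U r * f) k = if r ≤ k then monCoeff U f (k - r) else 0 := by
  induction hf using Submodule.span_induction with
  | mem f hf =>
    obtain ⟨p, -, rfl⟩ := hf
    have eq_iff : r + p = k ↔ r ≤ k ∧ p = k - r :=
      ⟨fun h => h ▸ ⟨le_self_add, (add_tsub_cancel_left r p).symm⟩,
        fun h => h.2 ▸ add_tsub_cancel_of_le h.1⟩
    rw [← mon_add, monCoeff_mon, monCoeff_mon, Finsupp.single_apply, Finsupp.single_apply,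
      ← ite_and]
    exact if_congr eq_iff rfl rfl
  | zero => simp
  | add f g _ _ hf hg =>
    rw [mul_add, map_add, map_add, Finsupp.add_apply, Finsupp.add_apply, hf, hg]
    split_ifs <;> simp
  | smul c f _ hf =>
    rw [mul_smul_comm, map_smul, map_smul, Finsupp.smul_apply, Finsupp.smul_apply, hf]
    split_ifs <;> simp

end Monomials

section DifferentialOperators

/-- The differential operator with the given coefficients. -/
def diffOp (U : Dom) : (ℕ × ℕ →₀ Smooth U) →ₗ[ℂ] Op U :=
  Finsupp.lsum ℂ fun p => (LinearMap.mulRight ℂ (dx U ^ p.1 * dy U ^ p.2)).comp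
    (Algebra.lmul ℂ (Smooth U)).toLinearMap

/-- The differential operators with derivatives `∂_x ^ i ∂_y ^ j`, `(i, j) ∈ S`. -/
def diffOps (U : Dom) (S : Set (ℕ × ℕ)) : Submodule ℂ (Op U) :=
  (Finsupp.supported (Smooth U) ℂ S).map (diffOp U)

variable {U : Dom} {S : Set (ℕ × ℕ)}

theorem diffOp_apply (f : ℕ × ℕ →₀ Smooth U) :
    diffOp U f = f.sum fun p g => mulOp U g * (dx U ^ p.1 * dy U ^ p.2) := rfl

theorem diffOp_single (p : ℕ × ℕ) (g : Smooth U) :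
    diffOp U (Finsupp.single p g) = mulOp U g * (dx U ^ p.1 * dy U ^ p.2) := by
  simp [diffOp_apply, mulOp]

theorem isDiffOpOn_iff_mem_diffOps {P : ℕ → ℕ → Prop} {T : Op U} :
    IsDiffOpOn U P T ↔ T ∈ diffOps U {p | P p.1 p.2} := by
  simp only [IsDiffOpOn, diffOps, Submodule.mem_map, diffOp_apply, mul_assoc]
  exact exists_congr fun f => and_congr Iff.rfl eq_comm

theorem diffOp_mon (f : ℕ × ℕ →₀ Smooth U) (p : ℕ × ℕ) :
    diffOp U f (mon U p) = f.sum fun i g =>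
      ((p.1.descFactorial i.1 * p.2.descFactorial i.2 : ℕ) : ℂ) • (mon U (p - i) * g) := by
  rw [diffOp_apply, Finsupp.sum, LinearMap.sum_apply]
  refine Finset.sum_congr rfl fun i _ => ?_
  rw [Module.End.mul_apply, mon, dx_pow_dy_pow_monomial, map_smul, mulOp, LinearMap.mulLeft_apply,
    mul_comm (f i)]
  rfl

theorem descFactorial_mul_descFactorial_eq_zero {p i : ℕ × ℕ} (h : ¬i ≤ p) :
    p.1.descFactorial i.1 * p.2.descFactorial i.2 = 0 := by
  rw [mul_eq_zero, Nat.descFactorial_eq_zero_iff_lt, Nat.descFactorial_eq_zero_iff_lt]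
  simpa [Prod.le_def, imp_iff_not_or] using h

/-- The system expressing the values on monomials by the coefficients is triangular. -/
theorem coeff_mem_of_diffOp_mon_mem {W : Submodule ℂ (Smooth U)}
    (hW : ∀ r, ∀ g ∈ W, mon U r * g ∈ W) (f : ℕ × ℕ →₀ Smooth U) (q : ℕ × ℕ)
    (h : ∀ p ≤ q, diffOp U f (mon U p) ∈ W) : f q ∈ W := by
  induction q using WellFoundedLT.induction with | ind q ih => ?_
  have lower_terms : ∀ i ∈ (f.erase q).support,
      ((q.1.descFactorial i.1 * q.2.descFactorial i.2 : ℕ) : ℂ) •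
        (mon U (q - i) * f.erase q i) ∈ W := fun i hi => by
    rw [Finsupp.support_erase] at hi
    rw [Finsupp.erase_ne (Finset.ne_of_mem_erase hi)]
    by_cases hle : i ≤ q
    · have hlt := lt_of_le_of_ne hle (Finset.ne_of_mem_erase hi)
      exact W.smul_mem _ (hW _ _ (ih i hlt fun p hp => h p (hp.trans hle)))
    · rw [descFactorial_mul_descFactorial_eq_zero hle, Nat.cast_zero, zero_smul]
      exact zero_mem _
  have top_term := h q le_rfl
  rw [diffOp_mon, ← Finsupp.add_sum_erase' f q _ (by simp), Finsupp.sum] at top_term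
  rw [Submodule.add_mem_iff_left _ (sum_mem lower_terms), Nat.descFactorial_self,
    Nat.descFactorial_self, Submodule.smul_mem_iff _ (Nat.cast_ne_zero.2 (by positivity)),
    tsub_self] at top_term
  simpa [mon] using top_term

theorem diffOp_injective : Function.Injective (diffOp U) :=
  (injective_iff_map_eq_zero _).2 fun f hf => Finsupp.ext fun q =>
    (Submodule.mem_bot ℂ).1 (coeff_mem_of_diffOp_mon_mem (W := ⊥) (by simp) f q (by simp [hf]))

theorem diffOps_inf (S S' : Set (ℕ × ℕ)) : diffOps U S ⊓ diffOps U S' = diffOps U (S ∩ S') := by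
  rw [diffOps, diffOps, diffOps, Finsupp.supported_inter,
    Submodule.map_inf (diffOp U) diffOp_injective]

theorem diffOps_mono {S S' : Set (ℕ × ℕ)} (h : S ⊆ S') : diffOps U S ≤ diffOps U S' :=
  Submodule.map_mono (Finsupp.supported_mono h)

theorem diffOp_single_mem_diffOps (g : Smooth U) {p : ℕ × ℕ} (hp : p ∈ S) :
    diffOp U (Finsupp.single p g) ∈ diffOps U S :=
  Submodule.mem_map_of_mem (Finsupp.single_mem_supported ℂ g hp)

theorem coeff_mem_monSpan_univ {N M N' M' : ℕ} {f : ℕ × ℕ →₀ Smooth U}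
    (hf : ∀ i ∈ f.support, i ≤ (N, M)) (maps : rect U N M ≤ (rect U N' M').comap (diffOp U f))
    (i : ℕ × ℕ) : f i ∈ monSpan U Set.univ := by
  by_cases hi : i ∈ f.support
  · refine coeff_mem_of_diffOp_mon_mem (fun r g hg => ?_) f i fun p hp => ?_
    · exact Submodule.span_mono (Set.image_mono (Set.subset_univ _)) (mon_mul_mem_monSpan r hg)
    · have image_mem := maps (mon_mem_rect (hp.trans (hf i hi)))
      rw [rect_eq_monSpan] at image_mem
      exact Submodule.span_mono (Set.image_mono (Set.subset_univ _)) image_mem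
  · rw [Finsupp.notMem_support_iff.1 hi]
    exact zero_mem _

end DifferentialOperators

section DescFactorial

variable {R : Type*} [CommRing R] [IsDomain R] [CharZero R]

theorem coeff_eq_zero_of_sum_descFactorial {a : ℕ} {c : ℕ → R} {s : Finset ℕ} (hs : a < s.card)
    (h : ∀ p ∈ s, ∑ i ∈ Finset.range (a + 1), p.descFactorial i * c i = 0) :
    ∀ i ≤ a, c i = 0 := by
  have degree_eq (i : ℕ) : (descPochhammer R i).degree = i := by
    rw [Polynomial.degree_eq_natDegree (monic_descPochhammer R i).ne_zero, descPochhammer_natDegree]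
  have sum_eq_zero : ∑ i ∈ Finset.range (a + 1), c i • descPochhammer R i = 0 := by
    refine Polynomial.eq_zero_of_degree_lt_of_eval_index_eq_zero s Nat.cast_injective.injOn
      ((Polynomial.degree_sum_le _ _).trans_lt ?_) fun p hp => ?_
    · refine (Finset.sup_lt_iff (WithBot.bot_lt_coe _)).2 fun i hi => ?_
      refine (Polynomial.degree_smul_le _ _).trans_lt ?_
      rw [degree_eq, Nat.cast_lt]
      exact (Finset.mem_range_succ_iff.1 hi).trans_lt hs
    · simpa [Polynomial.eval_finsetSum, descPochhammer_eval_eq_descFactorial, mul_comm] using h p hp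
  exact fun i hi => linearIndependent_iff'.1
    (Polynomial.Sequence.linearIndependent ⟨descPochhammer R, degree_eq⟩) _ c sum_eq_zero i
    (Finset.mem_range_succ_iff.2 hi)

theorem coeff_eq_zero_of_sum_descFactorial_mul_descFactorial {a b N M : ℕ} {c : ℕ → ℕ → R}
    {s : Finset ℕ} (hs : a < s.card) (haN : a ≤ N) (hbM : b ≤ M) (hc : ∀ i, a < i → c i b = 0)
    (h : ∀ p ∈ s, ∀ q ≤ M, ∑ i ∈ Finset.range (N + 1), ∑ j ∈ Finset.range (M + 1),
      (p.descFactorial i * q.descFactorial j : ℕ) * c i j = 0) : c a b = 0 := by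
  refine coeff_eq_zero_of_sum_descFactorial (c := (c · b)) hs (fun p hp => ?_) a le_rfl
  have row_eq_zero : ∑ i ∈ Finset.range (N + 1), p.descFactorial i * c i b = 0 := by
    refine coeff_eq_zero_of_sum_descFactorial (s := Finset.range (M + 1))
      (c := fun j => ∑ i ∈ Finset.range (N + 1), p.descFactorial i * c i j)
      (by simp) (fun q hq => ?_) b hbM
    rw [← h p hp q (Finset.mem_range_succ_iff.1 hq), Finset.sum_comm]
    simp only [Finset.mul_sum, Nat.cast_mul]
    exact Finset.sum_congr rfl fun j _ => Finset.sum_congr rfl fun i _ => by ring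
  rw [← row_eq_zero]
  refine Finset.sum_subset (Finset.range_mono (by lia)) fun i _ hi => ?_
  rw [hc i (by simpa using hi), mul_zero]

end DescFactorial

section LeadingCoefficients

/-- The degrees `p ≤ N` for which the degree `p + u - a` of `x ^ u ∂ ^ a (x ^ p)` lies outside
`[0, N']`. -/
def forbiddenDegrees (N N' a u : ℕ) : Finset ℕ :=
  {p ∈ Finset.range (N + 1) | p + u < a ∨ N' + a < p + u}

theorem lt_card_forbiddenDegrees {N N' a u : ℕ} (haN : a ≤ N) (h : ¬Admissible N N' a u) :
    a < (forbiddenDegrees N N' a u).card := by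
  have card_add := Finset.card_filter_add_card_filter_not (s := Finset.range (N + 1))
    (fun p => p + u < a ∨ N' + a < p + u)
  have card_le : ({p ∈ Finset.range (N + 1) | ¬(p + u < a ∨ N' + a < p + u)}).card ≤
      (Finset.Ico (a - u) (N' + a + 1 - u)).card :=
    Finset.card_le_card fun p hp => by
      rw [Finset.mem_filter] at hp
      exact Finset.mem_Ico.2 ⟨by lia, by lia⟩
  rw [Nat.card_Ico] at card_le
  rw [Finset.card_range] at card_add
  rw [forbiddenDegrees]
  rw [Admissible] at h
  lia

variable {U : Dom} [Nonempty U] {N M N' M' : ℕ} {f : ℕ × ℕ →₀ Smooth U}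

/-- The contribution of the coefficient of `∂_x ^ i.1 ∂_y ^ i.2` to the part of `diffOp U f` that
shifts the exponents of monomials by `w - r`. -/
def weightCoeff (f : ℕ × ℕ →₀ Smooth U) (r w i : ℕ × ℕ) : ℂ :=
  if r ≤ w + i then monCoeff U (f i) (w + i - r) else 0

theorem weightCoeff_self (f : ℕ × ℕ →₀ Smooth U) (r w : ℕ × ℕ) :
    weightCoeff f r w r = monCoeff U (f r) w := by
  rw [weightCoeff, if_pos le_add_self, add_tsub_cancel_right]

theorem weightCoeff_eq_zero {r w i : ℕ × ℕ} (hi : i ∉ f.support) : weightCoeff f r w i = 0 := by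
  rw [weightCoeff, Finsupp.notMem_support_iff.1 hi, map_zero, Finsupp.zero_apply, ite_self]

/-- The factor `mon U r` keeps the exponent `p + w - r` nonnegative. -/
theorem monCoeff_mon_mul_diffOp_mon (hf : ∀ i ∈ f.support, i ≤ (N, M))
    (hpoly : ∀ i, f i ∈ monSpan U Set.univ) (r w p : ℕ × ℕ) :
    monCoeff U (mon U r * diffOp U f (mon U p)) (p + w) =
      ∑ i ∈ Finset.range (N + 1), ∑ j ∈ Finset.range (M + 1),
        (p.1.descFactorial i * p.2.descFactorial j : ℕ) * weightCoeff f r w (i, j) := by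
  have term_eq (i : ℕ × ℕ) : monCoeff U (mon U r *
      (((p.1.descFactorial i.1 * p.2.descFactorial i.2 : ℕ) : ℂ) • (mon U (p - i) * f i))) (p + w) =
      (p.1.descFactorial i.1 * p.2.descFactorial i.2 : ℕ) * weightCoeff f r w i := by
    by_cases hi : i ≤ p
    · obtain ⟨q, rfl⟩ := exists_add_of_le hi
      have le_iff : r + q ≤ i + q + w ↔ r ≤ w + i := by
        rw [add_right_comm, add_le_add_iff_right, add_comm i]
      have sub_eq : i + q + w - (r + q) = w + i - r := by
        rw [add_right_comm, add_tsub_add_eq_tsub_right, add_comm i]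
      rw [mul_smul_comm, map_smul, Finsupp.smul_apply, smul_eq_mul, add_tsub_cancel_left,
        ← mul_assoc, ← mon_add, monCoeff_mon_mul (hpoly i), weightCoeff, sub_eq]
      simp only [le_iff]
    · rw [descFactorial_mul_descFactorial_eq_zero hi, Nat.cast_zero, zero_smul, mul_zero, map_zero,
        Finsupp.zero_apply, zero_mul]
  have support_subset : f.support ⊆ Finset.range (N + 1) ×ˢ Finset.range (M + 1) := fun i hi =>
    Finset.mem_product.2 ((hf i hi).imp Finset.mem_range_succ_iff.2 Finset.mem_range_succ_iff.2)
  rw [← Finset.sum_product' _ _ fun i j =>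
      ((p.1.descFactorial i * p.2.descFactorial j : ℕ) : ℂ) * weightCoeff f r w (i, j),
    diffOp_mon, Finsupp.sum, Finset.mul_sum, map_sum, Finsupp.finsetSum_apply]
  simp only [term_eq]
  exact Finset.sum_subset support_subset fun i _ hi => by rw [weightCoeff_eq_zero hi, mul_zero]

theorem monCoeff_mon_mul_eq_zero {g : Smooth U} (hg : g ∈ rect U N' M') {r w p : ℕ × ℕ}
    (h : p.1 ∈ forbiddenDegrees N N' r.1 w.1 ∨
      p.2 ∈ forbiddenDegrees M M' r.2 w.2) : monCoeff U (mon U r * g) (p + w) = 0 := by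
  rw [rect_eq_monSpan] at hg
  by_contra hne
  obtain ⟨k, hk, hkw⟩ := (mem_monSpan_iff.1 (mon_mul_mem_monSpan r hg)).2 _ hne
  obtain ⟨hk₁, hk₂⟩ := Prod.le_def.1 (Set.mem_Iic.1 hk)
  obtain ⟨h₁, h₂⟩ := Prod.ext_iff.1 hkw
  simp only [Prod.fst_add, Prod.snd_add] at h₁ h₂
  simp only [forbiddenDegrees, Finset.mem_filter] at h
  lia

theorem top_coeff_mem_monSpan {a b : ℕ} (hf : ∀ i ∈ f.support, i ≤ (N, M))
    (maps : rect U N M ≤ (rect U N' M').comap (diffOp U f)) (haN : a ≤ N) (hbM : b ≤ M)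
    (order : ∀ i ∈ f.support, i.1 + i.2 ≤ a + b) :
    f (a, b) ∈ monSpan U {w | Admissible N N' a w.1 ∧ Admissible M M' b w.2} := by
  have hpoly := coeff_mem_monSpan_univ hf maps
  refine mem_monSpan_iff.2 ⟨hpoly _, fun w hw => ?_⟩
  rw [← weightCoeff_self] at hw
  have sum_eq_zero {p q : ℕ} (hp : p ≤ N) (hq : q ≤ M) (h : p ∈ forbiddenDegrees N N' a w.1 ∨
      q ∈ forbiddenDegrees M M' b w.2) :
      ∑ i ∈ Finset.range (N + 1), ∑ j ∈ Finset.range (M + 1),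
        (p.descFactorial i * q.descFactorial j : ℕ) * weightCoeff f (a, b) w (i, j) = 0 := by
    rw [← monCoeff_mon_mul_diffOp_mon hf hpoly (a, b) w (p, q)]
    exact monCoeff_mon_mul_eq_zero (maps (mon_mem_rect ⟨hp, hq⟩)) h
  have of_order {i : ℕ × ℕ} (hi : a + b < i.1 + i.2) : weightCoeff f (a, b) w i = 0 :=
    weightCoeff_eq_zero fun h => (order i h).not_gt hi
  have le_of_mem {L L' c u p : ℕ} (h : p ∈ forbiddenDegrees L L' c u) : p ≤ L :=
    Finset.mem_range_succ_iff.1 (Finset.mem_filter.1 h).1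
  refine ⟨of_not_not fun hna => hw ?_, of_not_not fun hnb => hw ?_⟩
  · exact coeff_eq_zero_of_sum_descFactorial_mul_descFactorial
      (c := fun i j => weightCoeff f (a, b) w (i, j)) (lt_card_forbiddenDegrees haN hna) haN hbM
      (fun i hi => of_order (by simpa using hi))
      fun p hp q hq => sum_eq_zero (le_of_mem hp) hq (.inl hp)
  · refine coeff_eq_zero_of_sum_descFactorial_mul_descFactorial
      (c := fun j i => weightCoeff f (a, b) w (i, j)) (lt_card_forbiddenDegrees hbM hnb) hbM haN
      (fun j hj => of_order (by simpa using hj)) fun q hq p hp => ?_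
    rw [Finset.sum_comm, ← sum_eq_zero hp (le_of_mem hq) (.inr hq)]
    simp only [mul_comm]

end LeadingCoefficients

theorem mul_sub_mul_mem {R A : Type*} [CommRing R] [Ring A] [Algebra R A] {L : Submodule R A}
    {P Q P' Q' : A} (hP : (P - P') * Q ∈ L) (hQ : P' * (Q - Q') ∈ L) : P * Q - P' * Q' ∈ L := by
  rw [← sub_add_sub_cancel _ (P' * Q), ← sub_mul, ← mul_sub]
  exact add_mem hP hQ

section ScalarOperators

variable {U : Dom} {a b k N M N' M' : ℕ} {BX BY : ℕ → Set (Op U)}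

/-- The exponents `(i, j)` of the derivatives of order less than `k` with `i ≤ N` and `j ≤ M`. -/
def derivBox (N M k : ℕ) : Set (ℕ × ℕ) := {i | i ≤ (N, M) ∧ i.1 + i.2 < k}

/-- The products of an operator from `BX a` of order at most `a` in `x` and an operator from `BY b`
of order at most `b` in `y`, with `a + b < k`. -/
def productsLT (BX BY : ℕ → Set (Op U)) (k : ℕ) : Set (Op U) :=
  {R | ∃ a b, a + b < k ∧ ∃ P ∈ BX a, P ∈ ordLT ℂ (mulOp U (x U)) (dx U) (a + 1) ∧
    ∃ Q ∈ BY b, Q ∈ ordLT ℂ (mulOp U (y U)) (dy U) (b + 1) ∧ R = P * Q}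

theorem productsLT_mono {l : ℕ} (h : k ≤ l) : productsLT BX BY k ⊆ productsLT BX BY l :=
  fun _ ⟨a, b, hab, hR⟩ => ⟨a, b, hab.trans_le h, hR⟩

theorem pow_mul_pow_mul_pow_mul_pow (u v i j : ℕ) :
    mulOp U (x U) ^ u * dx U ^ i * (mulOp U (y U) ^ v * dy U ^ j) =
      diffOp U (Finsupp.single (i, j) (mon U (u, v))) := by
  rw [diffOp_single, mon, mulOp_mul, mulOp_pow, mulOp_pow,
    ((commute_dx_mulOp_y (U := U)).pow_pow i v).mul_mul_mul_comm]

theorem mul_mem_diffOps {P Q : Op U} (hP : P ∈ ordLT ℂ (mulOp U (x U)) (dx U) a)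
    (hQ : Q ∈ ordLT ℂ (mulOp U (y U)) (dy U) b) : P * Q ∈ diffOps U (Set.Iio a ×ˢ Set.Iio b) := by
  suffices ordLT ℂ (mulOp U (x U)) (dx U) a * ordLT ℂ (mulOp U (y U)) (dy U) b ≤
      diffOps U (Set.Iio a ×ˢ Set.Iio b) from this (Submodule.mul_mem_mul hP hQ)
  rw [ordLT, ordLT, Submodule.span_mul_span]
  refine Submodule.span_le.2 ?_
  rintro _ ⟨_, ⟨u, i, hi, rfl⟩, _, ⟨v, j, hj, rfl⟩, rfl⟩
  simp only [pow_mul_pow_mul_pow_mul_pow]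
  exact diffOp_single_mem_diffOps _ ⟨hi, hj⟩

theorem HasLead.mul_sub_mem_diffOps {P Q : Op U} {u v : ℕ} (haN : a ≤ N) (hbM : b ≤ M)
    (hP : HasLead ℂ (mulOp U (x U)) (dx U) P u a) (hQ : HasLead ℂ (mulOp U (y U)) (dy U) Q v b) :
    P * Q - diffOp U (Finsupp.single (a, b) (mon U (u, v))) ∈
      diffOps U (derivBox N M (a + b)) := by
  rw [← pow_mul_pow_mul_pow_mul_pow]
  refine mul_sub_mul_mem (R := ℂ) (A := Op U) (L := diffOps U (derivBox N M (a + b)))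
    (diffOps_mono (U := U) ?_ (mul_mem_diffOps hP hQ.mem_ordLT))
    (diffOps_mono (U := U) ?_ (mul_mem_diffOps (pow_mul_pow_mem_ordLT u a.lt_succ_self) hQ))
  all_goals
    rintro ⟨i, j⟩ ⟨hi, hj⟩
    rw [Set.mem_Iio] at hi hj
    exact ⟨⟨by lia, by lia⟩, by lia⟩

variable (hX : IsAdapted (fun j i => x U ^ i * y U ^ j) (mulOp U (x U)) (dx U) N N' BX)
  (hY : IsAdapted (fun i j => x U ^ i * y U ^ j) (mulOp U (y U)) (dy U) M M' BY)
include hX hY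

theorem exists_product_of_admissible {w : ℕ × ℕ} (haN : a ≤ N) (hbM : b ≤ M)
    (ha : Admissible N N' a w.1) (hb : Admissible M M' b w.2) :
    ∃ R ∈ productsLT BX BY (a + b + 1) ∩ (rect U N M).compatibleMaps (rect U N' M'),
      R - diffOp U (Finsupp.single (a, b) (mon U w)) ∈ diffOps U (derivBox N M (a + b)) := by
  obtain ⟨P, hP, leadP, mapsP⟩ := hX a w.1 ha
  obtain ⟨Q, hQ, leadQ, mapsQ⟩ := hY b w.2 hb
  refine ⟨P * Q, ⟨⟨a, b, Nat.lt_succ_self _, P, hP, leadP.mem_ordLT, Q, hQ, leadQ.mem_ordLT, rfl⟩,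
    fun f hf => ?_⟩, leadP.mul_sub_mem_diffOps haN hbM leadQ⟩
  rw [rect_eq_ladder_y] at hf
  have mem_mid := mapsQ _ hf
  rw [← rect_eq_ladder_y, rect_eq_ladder_x] at mem_mid
  rw [rect_eq_ladder_x]
  exact mapsP _ mem_mid

theorem diffOp_single_mem_span_sup_diffOps {g : Smooth U} (haN : a ≤ N) (hbM : b ≤ M)
    (hg : g ∈ monSpan U {w | Admissible N N' a w.1 ∧ Admissible M M' b w.2}) :
    diffOp U (Finsupp.single (a, b) g) ∈
      Submodule.span ℂ
        (productsLT BX BY (a + b + 1) ∩ (rect U N M).compatibleMaps (rect U N' M')) ⊔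
      diffOps U (derivBox N M (a + b)) := by
  induction hg using Submodule.span_induction with
  | mem g hg =>
    obtain ⟨w, ⟨ha, hb⟩, rfl⟩ := hg
    obtain ⟨R, hR, lower⟩ := exists_product_of_admissible hX hY haN hbM ha hb
    rw [← sub_sub_cancel R (diffOp U _)]
    exact Submodule.sub_mem _ (Submodule.mem_sup_left (Submodule.subset_span hR))
      (Submodule.mem_sup_right lower)
  | zero => rw [Finsupp.single_zero, map_zero]; exact zero_mem _
  | add g g' _ _ hg hg' => rw [Finsupp.single_add, map_add]; exact add_mem hg hg'
  | smul c g _ hg =>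
    rw [← Finsupp.smul_single, map_smul]
    exact Submodule.smul_mem _ c hg

theorem diffOps_inf_compatibleMaps_le_sup (k : ℕ) :
    diffOps U (derivBox N M (k + 1)) ⊓ (rect U N M).compatibleMaps (rect U N' M') ≤
      Submodule.span ℂ (productsLT BX BY (k + 1) ∩ (rect U N M).compatibleMaps (rect U N' M')) ⊔
      diffOps U (derivBox N M k) := by
  rintro _ ⟨⟨f, hf, rfl⟩, maps⟩
  rw [SetLike.mem_coe, Finsupp.mem_supported] at hf
  rcases isEmpty_or_nonempty U with _ | _
  · rw [Subsingleton.elim f 0, map_zero]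
    exact zero_mem _
  rw [← f.sum_single, map_finsuppSum]
  refine sum_mem fun ⟨a, b⟩ hi => ?_
  obtain ⟨⟨haN, hbM⟩, hk⟩ := hf hi
  rcases (Nat.lt_succ_iff.1 hk).lt_or_eq with hlt | rfl
  · exact Submodule.mem_sup_right (diffOp_single_mem_diffOps _ ⟨⟨haN, hbM⟩, hlt⟩)
  · exact diffOp_single_mem_span_sup_diffOps hX hY haN hbM
      (top_coeff_mem_monSpan (fun i hi => (hf hi).1) maps haN hbM
        fun i hi => Nat.lt_succ_iff.1 (hf hi).2)

theorem diffOps_inf_compatibleMaps_le_span (k : ℕ) :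
    diffOps U (derivBox N M k) ⊓ (rect U N M).compatibleMaps (rect U N' M') ≤
      Submodule.span ℂ (productsLT BX BY k) := by
  induction k with
  | zero => simp [derivBox, diffOps]
  | succ k ih =>
    rintro T ⟨order, maps⟩
    obtain ⟨E, hE, L, hL, rfl⟩ :=
      Submodule.mem_sup.1 (diffOps_inf_compatibleMaps_le_sup hX hY k ⟨order, maps⟩)
    have mapsE : E ∈ (rect U N M).compatibleMaps (rect U N' M') :=
      Submodule.span_le.2 Set.inter_subset_right hE
    have mapsL : L ∈ (rect U N M).compatibleMaps (rect U N' M') := fun f hf =>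
      (Submodule.add_mem_iff_right (rect U N' M') (mapsE hf)).1 (maps hf)
    exact add_mem (Submodule.span_mono Set.inter_subset_left hE)
      (Submodule.span_mono (productsLT_mono k.le_succ) (ih ⟨hL, mapsL⟩))

end ScalarOperators

section Commutation

variable {A : Type*} [Ring A] [Algebra ℂ A] {X D Z : A} (hX : Commute Z X) (hD : Commute Z D)
include hX hD

theorem commute_euler_sub (c : ℂ) : Commute Z (X * D - algebraMap ℂ A c) :=
  (hX.mul_right hD).sub_right (Algebra.commutes c Z).symm

theorem commute_slPM (c : ℂ) (μ : Sgn) : Commute Z (slPM X D c μ) := by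
  cases μ with
  | plus => exact ((hX.pow_right 2).mul_right hD).sub_right (hX.smul_right c)
  | minus => exact hD

theorem commute_qbar (n Δ α : ℕ) : Commute Z (qbar X D n Δ α) := by
  rw [qbar_eq]
  refine (Commute.list_prod_right _ _ fun P hP => ?_).mul_right (hD.pow_right α)
  obtain ⟨k, _, rfl⟩ := List.mem_map.1 hP
  exact commute_euler_sub hX hD _

theorem commute_slPM_pow_mul_slZero_pow (c : ℂ) (μ : Sgn) (i s : ℕ) :
    Commute Z (slPM X D c μ ^ i * slZero X D c ^ s) :=
  ((commute_slPM hX hD c μ).pow_right i).mul_right ((commute_euler_sub hX hD _).pow_right s)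

end Commutation

section MatrixUnits

theorem single_mul_diagonal {ι A : Type*} [Fintype ι] [DecidableEq ι] [Semiring A] (i j : ι) (c : A)
    (d : ι → A) : Matrix.single i j c * Matrix.diagonal d = Matrix.single i j (c * d j) := by
  ext a b
  rw [Matrix.mul_diagonal, Matrix.single_apply, Matrix.single_apply]
  split_ifs with h
  · rw [h.2]
  · rw [zero_mul]

theorem single_self_eq_smul_add_smul {A : Type*} [Ring A] [Algebra ℂ A] (l : Fin 2)
    (d : Fin 2 → A) : Matrix.single l l (d l) = (1 / 2 : ℂ) • Matrix.diagonal d +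
      (![1 / 2, -(1 / 2)] l : ℂ) • (Matrix.diagonal ![1, -1] * Matrix.diagonal d) := by
  have halves (c : A) : (2⁻¹ : ℂ) • c + (2⁻¹ : ℂ) • c = c := by
    rw [← add_smul, ← two_mul, mul_inv_cancel₀ two_ne_zero, one_smul]
  rw [Matrix.diagonal_mul_diagonal]
  ext a b
  fin_cases l <;> fin_cases a <;> fin_cases b <;> simp [halves]

theorem single_self_mem_of_diagonal_mem {U : Dom} {W : Submodule ℂ (MatOp U)} {d : Fin 2 → Op U}
    (hd : Matrix.diagonal d ∈ W) (hJd : Jtilde U * Matrix.diagonal d ∈ W) (l : Fin 2) :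
    Matrix.single l l (d l) ∈ W := by
  have split := single_self_eq_smul_add_smul (A := Op U) l d
  exact split ▸ add_mem (Submodule.smul_mem W _ hd) (Submodule.smul_mem W _ hJd)

end MatrixUnits

/-- The row of `σ^±`. -/
def Sgn.row : Sgn → Fin 2
  | .plus => 0
  | .minus => 1

/-- The column of `σ^±`. -/
def Sgn.col : Sgn → Fin 2
  | .plus => 1
  | .minus => 0

/-- The factor of `Q^±_{αβ}` in the variable `x`. -/
def xFactor (U : Dom) (n Δ : ℕ) : Sgn → ℕ → Op U
  | .plus => qbar (mulOp U (x U)) (dx U) n Δ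
  | .minus => fun α => mulOp U (x U) ^ α

/-- The factor of `Q^±_{αβ}` in the variable `y`. -/
def yFactor (U : Dom) (m Γ : ℕ) : Sgn → ℕ → Op U
  | .plus => fun β => mulOp U (y U) ^ β
  | .minus => qbar (mulOp U (y U)) (dy U) m Γ

section MatrixMonomials

variable {U : Dom} {n m Δ Γ : ℕ}

theorem exists_sgn_of_ne {i j : Fin 2} (h : i ≠ j) : ∃ ε : Sgn, i = ε.row ∧ j = ε.col := by
  fin_cases i <;> fin_cases j
  · exact absurd rfl h
  · exact ⟨.plus, rfl, rfl⟩
  · exact ⟨.minus, rfl, rfl⟩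
  · exact absurd rfl h

theorem Q_eq_single (ε : Sgn) (α β : ℕ) :
    Q U n m Δ Γ ε α β = Matrix.single ε.row ε.col (xFactor U n Δ ε α * yFactor U m Γ ε β) := by
  cases ε <;> ext a b : 2 <;> fin_cases a <;> fin_cases b <;> rfl

theorem S_pow_eq_diagonal (hΔ : Δ ≤ n) (μ : Sgn) (i : ℕ) : S U n Δ μ ^ i =
    Matrix.diagonal fun l => slPM (mulOp U (x U)) (dx U) (xDeg n Δ l) μ ^ i := by
  rw [S, Matrix.diagonal_pow, ← Nat.cast_sub hΔ]
  congr 1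
  funext l
  fin_cases l <;> rfl

theorem S0_pow_eq_diagonal (hΔ : Δ ≤ n) (s : ℕ) : S0 U n Δ ^ s =
    Matrix.diagonal fun l => slZero (mulOp U (x U)) (dx U) (xDeg n Δ l) ^ s := by
  rw [S0, Matrix.diagonal_pow, ← Nat.cast_sub hΔ]
  congr 1
  funext l
  fin_cases l <;> rfl

theorem T_pow_eq_diagonal (hΓ : Γ ≤ m) (ν : Sgn) (j : ℕ) : T U m Γ ν ^ j =
    Matrix.diagonal fun l => slPM (mulOp U (y U)) (dy U) (yDeg m Γ l) ν ^ j := by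
  rw [T, Matrix.diagonal_pow, ← Nat.cast_sub hΓ]
  congr 1
  funext l
  fin_cases l <;> rfl

theorem T0_pow_eq_diagonal (hΓ : Γ ≤ m) (t : ℕ) : T0 U m Γ ^ t =
    Matrix.diagonal fun l => slZero (mulOp U (y U)) (dy U) (yDeg m Γ l) ^ t := by
  rw [T0, Matrix.diagonal_pow, ← Nat.cast_sub hΓ]
  congr 1
  funext l
  fin_cases l <;> rfl

theorem S_pow_mul_S0_pow (hΔ : Δ ≤ n) (μ : Sgn) (i s : ℕ) : S U n Δ μ ^ i * S0 U n Δ ^ s =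
    Matrix.diagonal fun l => slPM (mulOp U (x U)) (dx U) (xDeg n Δ l) μ ^ i *
      slZero (mulOp U (x U)) (dx U) (xDeg n Δ l) ^ s := by
  rw [S_pow_eq_diagonal hΔ, S0_pow_eq_diagonal hΔ, Matrix.diagonal_mul_diagonal]

theorem T_pow_mul_T0_pow (hΓ : Γ ≤ m) (ν : Sgn) (j t : ℕ) : T U m Γ ν ^ j * T0 U m Γ ^ t =
    Matrix.diagonal fun l => slPM (mulOp U (y U)) (dy U) (yDeg m Γ l) ν ^ j *
      slZero (mulOp U (y U)) (dy U) (yDeg m Γ l) ^ t := by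
  rw [T_pow_eq_diagonal hΓ, T0_pow_eq_diagonal hΓ, Matrix.diagonal_mul_diagonal]

theorem commute_mulOp_x_yFactor (ε : Sgn) (β : ℕ) :
    Commute (mulOp U (x U)) (yFactor U m Γ ε β) := by
  have commute_x_y : Commute (mulOp U (x U)) (mulOp U (y U)) := commute_mulOp _ _
  cases ε with
  | plus => exact commute_x_y.pow_right β
  | minus => exact commute_qbar (A := Op U) commute_x_y (commute_dy_mulOp_x (U := U)).symm m Γ β

theorem commute_dx_yFactor (ε : Sgn) (β : ℕ) : Commute (dx U) (yFactor U m Γ ε β) := by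
  cases ε with
  | plus => exact commute_dx_mulOp_y.pow_right β
  | minus => exact commute_qbar (A := Op U) commute_dx_mulOp_y (wirtinger_comm _ _) m Γ β

theorem commute_yFactor_slPM_pow_mul_slZero_pow (ε : Sgn) (β : ℕ) (c : ℂ) (μ : Sgn) (i s : ℕ) :
    Commute (yFactor U m Γ ε β)
      (slPM (mulOp U (x U)) (dx U) c μ ^ i * slZero (mulOp U (x U)) (dx U) c ^ s) :=
  commute_slPM_pow_mul_slZero_pow (A := Op U) (commute_mulOp_x_yFactor (U := U) ε β).symm
    (commute_dx_yFactor (U := U) ε β).symm c μ i s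

theorem commute_yFactor_slPM_pow (ε : Sgn) (β : ℕ) (c : ℂ) (μ : Sgn) (i : ℕ) :
    Commute (yFactor U m Γ ε β) (slPM (mulOp U (x U)) (dx U) c μ ^ i) := by
  simpa only [pow_zero, mul_one] using
    commute_yFactor_slPM_pow_mul_slZero_pow (U := U) (m := m) (Γ := Γ) ε β c μ i 0

theorem single_eq_Q_mul {ε : Sgn} {α β : ℕ} {d d' : Fin 2 → Op U}
    (h : Commute (yFactor U m Γ ε β) (d ε.col)) :
    Matrix.single ε.row ε.col (xFactor U n Δ ε α * d ε.col * (yFactor U m Γ ε β * d' ε.col)) =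
      Q U n m Δ Γ ε α β * Matrix.diagonal d * Matrix.diagonal d' := by
  rw [Q_eq_single, single_mul_diagonal, single_mul_diagonal, h.symm.mul_mul_mul_comm,
    mul_assoc _ (d _)]

theorem single_mem_basisR (hΔ : Δ ≤ n) (hΓ : Γ ≤ m) {ε : Sgn} {P P' : Op U}
    (hP : P ∈ qFactors (mulOp U (x U)) (dx U) (xDeg n Δ ε.col) ε.opp (xFactor U n Δ ε) Δ)
    (hP' : P' ∈ qFactors (mulOp U (y U)) (dy U) (yDeg m Γ ε.col) ε (yFactor U m Γ ε) Γ) :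
    Matrix.single ε.row ε.col (P * P') ∈ basisR U n m Δ Γ := by
  rcases hP with ⟨_, _, ⟨μ, i, s, -, rfl⟩, rfl⟩ | ⟨α, i, hα, hαΔ, rfl⟩ <;>
    rcases hP' with ⟨_, _, ⟨ν, j, t, -, rfl⟩, rfl⟩ | ⟨β, j, hβ, hβΓ, rfl⟩
  · refine .inl (.inl (.inl ⟨_, .inr (.inr ⟨ε, rfl⟩), μ, ν, i, s, j, t, ?_⟩))
    rw [mul_assoc _ (S U n Δ μ ^ i), mul_assoc _ (T U m Γ ν ^ j), S_pow_mul_S0_pow hΔ,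
      T_pow_mul_T0_pow hΓ, ← single_eq_Q_mul (commute_yFactor_slPM_pow_mul_slZero_pow ε 0 _ μ i s)]
  · refine .inl (.inr ⟨ε, μ, β, i, s, j, hβ, hβΓ, ?_⟩)
    rw [mul_assoc _ (S U n Δ μ ^ i), S_pow_mul_S0_pow hΔ, T_pow_eq_diagonal hΓ,
      ← single_eq_Q_mul (commute_yFactor_slPM_pow_mul_slZero_pow ε β _ μ i s)]
  · refine .inl (.inl (.inr ⟨ε, ν, α, i, j, t, hα, hαΔ, ?_⟩))
    rw [mul_assoc _ (T U m Γ ν ^ j), S_pow_eq_diagonal hΔ, T_pow_mul_T0_pow hΓ,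
      ← single_eq_Q_mul (commute_yFactor_slPM_pow ε 0 _ _ i)]
  · refine .inr ⟨ε, α, β, i, j, hα, hαΔ, hβ, hβΓ, ?_⟩
    rw [S_pow_eq_diagonal hΔ, T_pow_eq_diagonal hΓ,
      ← single_eq_Q_mul (commute_yFactor_slPM_pow ε β _ _ i)]

theorem isAdapted_xFactor (hΔ : Δ ≤ n) (ε : Sgn) :
    IsAdapted (fun j i => x U ^ i * y U ^ j) (mulOp U (x U)) (dx U) (xDeg n Δ ε.col)
      (xDeg n Δ ε.row) fun _ =>
        qFactors (mulOp U (x U)) (dx U) (xDeg n Δ ε.col) ε.opp (xFactor U n Δ ε) Δ := by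
  cases ε with
  | plus => exact isAdapted_lowering isLadder_x dx_mul_mulOp_x hΔ
  | minus =>
    have raising := isAdapted_raising isLadder_x (dx_mul_mulOp_x (U := U)) (n - Δ) Δ
    rwa [Nat.sub_add_cancel hΔ] at raising

theorem isAdapted_yFactor (hΓ : Γ ≤ m) (ε : Sgn) :
    IsAdapted (fun i j => x U ^ i * y U ^ j) (mulOp U (y U)) (dy U) (yDeg m Γ ε.col)
      (yDeg m Γ ε.row) fun _ =>
        qFactors (mulOp U (y U)) (dy U) (yDeg m Γ ε.col) ε (yFactor U m Γ ε) Γ := by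
  cases ε with
  | plus =>
    have raising := isAdapted_raising isLadder_y (dy_mul_mulOp_y (U := U)) (m - Γ) Γ
    rwa [Nat.sub_add_cancel hΓ] at raising
  | minus => exact isAdapted_lowering isLadder_y dy_mul_mulOp_y hΓ

end MatrixMonomials

section Order

variable {U : Dom} {k : ℕ}

theorem orderLE_iff {M : MatOp U} :
    OrderLE U k M ↔ ∀ i j, M i j ∈ diffOps U {p | p.1 + p.2 ≤ k} :=
  forall₂_congr fun _ _ => isDiffOpOn_iff_mem_diffOps

theorem orderLE_single {P : Op U} (i j : Fin 2) (hP : P ∈ diffOps U {p | p.1 + p.2 ≤ k}) :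
    OrderLE U k (Matrix.single i j P) := orderLE_iff.2 fun a b => by
  rw [Matrix.single_apply]
  split_ifs
  exacts [hP, zero_mem _]

theorem orderLE_diagonal {d : Fin 2 → Op U} (hd : ∀ l, d l ∈ diffOps U {p | p.1 + p.2 ≤ k}) :
    OrderLE U k (Matrix.diagonal d) := orderLE_iff.2 fun a b => by
  rw [Matrix.diagonal_apply]
  split_ifs
  exacts [hd a, zero_mem _]

theorem OrderLE.jtilde_mul {M : MatOp U} (hM : OrderLE U k M) : OrderLE U k (Jtilde U * M) :=
  orderLE_iff.2 fun a b => by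
    have h := orderLE_iff.1 hM a b
    rw [Jtilde, Matrix.diagonal_mul]
    fin_cases a
    · exact (one_mul (M 0 b)).symm ▸ h
    · have neg : (-1 : Op U) * M 1 b = (-1 : ℂ) • M 1 b :=
        LinearMap.ext fun f => (neg_one_smul ℂ (M 1 b f)).symm
      exact neg ▸ Submodule.smul_mem _ (-1 : ℂ) h

theorem mul_mem_diffOps_of_add_le {a b : ℕ} {P P' : Op U} (hab : a + b ≤ k)
    (hP : P ∈ ordLT ℂ (mulOp U (x U)) (dx U) (a + 1))
    (hP' : P' ∈ ordLT ℂ (mulOp U (y U)) (dy U) (b + 1)) :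
    P * P' ∈ diffOps U {p | p.1 + p.2 ≤ k} := by
  refine diffOps_mono (U := U) ?_ (mul_mem_diffOps hP hP')
  rintro ⟨i, j⟩ ⟨hi, hj⟩
  rw [Set.mem_Iio] at hi hj
  exact show i + j ≤ k by lia

end Order

section Complement

variable {U : Dom} {n m Δ Γ k : ℕ}

variable (U n m Δ Γ k) in
/-- The span of the monomials in `basisR` of order at most `k`. -/
def basisSpan : Submodule ℂ (MatOp U) :=
  Submodule.span ℂ {M | M ∈ basisR U n m Δ Γ ∧ OrderLE U k M}

theorem mem_basisSpan {M : MatOp U} (hM : M ∈ basisR U n m Δ Γ) (hk : OrderLE U k M) :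
    M ∈ basisSpan U n m Δ Γ k := Submodule.subset_span ⟨hM, hk⟩

theorem single_mem_of_mem_span {W : Submodule ℂ (MatOp U)} {s : Set (Op U)} {i j : Fin 2}
    (h : ∀ P ∈ s, Matrix.single i j P ∈ W) {P : Op U} (hP : P ∈ Submodule.span ℂ s) :
    Matrix.single i j P ∈ W :=
  (Submodule.span_le (p := W.comap (Matrix.singleLinearMap ℂ i j))).2 h hP

theorem single_self_mul_mem_basisSpan (hΔ : Δ ≤ n) (hΓ : Γ ≤ m) {a b : ℕ} (hab : a + b ≤ k)
    {l : Fin 2} {P P' : Op U}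
    (hP : P ∈ slMonomials (mulOp U (x U)) (dx U) (xDeg n Δ l) a)
    (hP' : P' ∈ slMonomials (mulOp U (y U)) (dy U) (yDeg m Γ l) b) :
    Matrix.single l l (P * P') ∈ basisSpan U n m Δ Γ k := by
  obtain ⟨μ, i, s, rfl, rfl⟩ := hP
  obtain ⟨ν, j, t, rfl, rfl⟩ := hP'
  let d : Fin 2 → Op U := fun l =>
    slPM (mulOp U (x U)) (dx U) (xDeg n Δ l) μ ^ i *
        slZero (mulOp U (x U)) (dx U) (xDeg n Δ l) ^ s *
      (slPM (mulOp U (y U)) (dy U) (yDeg m Γ l) ν ^ j *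
        slZero (mulOp U (y U)) (dy U) (yDeg m Γ l) ^ t)
  have diagonal_eq : Matrix.diagonal d =
      S U n Δ μ ^ i * S0 U n Δ ^ s * (T U m Γ ν ^ j * T0 U m Γ ^ t) := by
    rw [S_pow_mul_S0_pow hΔ, T_pow_mul_T0_pow hΓ, Matrix.diagonal_mul_diagonal]
  have order_d : OrderLE U k (Matrix.diagonal d) := orderLE_diagonal fun l =>
    mul_mem_diffOps_of_add_le hab
      (slPM_pow_mul_slZero_pow_mem_ordLT (A := Op U) dx_mul_mulOp_x _ μ i s)
      (slPM_pow_mul_slZero_pow_mem_ordLT (A := Op U) dy_mul_mulOp_y _ ν j t)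
  refine single_self_mem_of_diagonal_mem (d := d)
    (mem_basisSpan (.inl (.inl (.inl ⟨1, .inl rfl, μ, ν, i, s, j, t, ?_⟩))) order_d)
    (mem_basisSpan (.inl (.inl (.inl ⟨_, .inr (.inl rfl), μ, ν, i, s, j, t, ?_⟩)))
      order_d.jtilde_mul) l
  · rw [diagonal_eq, one_mul, mul_assoc _ (T U m Γ ν ^ j)]
  · simp only [diagonal_eq, mul_assoc]

theorem entry_mem_compatibleMaps {D : MatOp U} (hD : D ∈ complementR U n m Δ Γ) (i j : Fin 2) :
    D i j ∈ (rect U (xDeg n Δ j) (yDeg m Γ j)).compatibleMaps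
      (rect U (xDeg n Δ i) (yDeg m Γ i)) := by
  intro g hg
  have single_mem : Pi.single j g ∈ rect2 U n m Δ Γ := by
    rw [rect2, Submodule.mem_pi]
    intro l _
    by_cases hl : l = j
    · subst hl
      rwa [Pi.single_eq_same]
    · rw [Pi.single_eq_of_ne hl]
      exact zero_mem _
  have act_mem := Submodule.mem_pi.1 (hD.1 _ single_mem) i trivial
  rwa [act, Finset.sum_eq_single j (fun l _ hl => by rw [Pi.single_eq_of_ne hl, map_zero])
    (fun h => absurd (Finset.mem_univ j) h), Pi.single_eq_same] at act_mem

theorem entry_mem_diffOps {D : MatOp U} (hD : D ∈ complementR U n m Δ Γ) (hk : OrderLE U k D)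
    (i j : Fin 2) : D i j ∈ diffOps U (derivBox (xDeg n Δ j) (yDeg m Γ j) (k + 1)) := by
  have mem_inf :=
    Submodule.mem_inf.2 ⟨isDiffOpOn_iff_mem_diffOps.1 (hD.2 i j), orderLE_iff.1 hk i j⟩
  rw [diffOps_inf] at mem_inf
  refine diffOps_mono ?_ mem_inf
  rintro p ⟨hp, hpk⟩
  exact ⟨hp, Nat.lt_succ_iff.2 hpk⟩

theorem single_entry_mem_basisSpan (hΔ : Δ ≤ n) (hΓ : Γ ≤ m) {D : MatOp U}
    (hD : D ∈ complementR U n m Δ Γ) (hk : OrderLE U k D) (i j : Fin 2) :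
    Matrix.single i j (D i j) ∈ basisSpan U n m Δ Γ k := by
  have mem_inf := And.intro (entry_mem_diffOps hD hk i j) (entry_mem_compatibleMaps hD i j)
  rcases eq_or_ne i j with rfl | hij
  · refine single_mem_of_mem_span ?_ (diffOps_inf_compatibleMaps_le_span
      (isAdapted_slMonomials isLadder_x dx_mul_mulOp_x _)
      (isAdapted_slMonomials isLadder_y dy_mul_mulOp_y _) (k + 1) mem_inf)
    rintro _ ⟨a, b, hab, P, hP, -, P', hP', -, rfl⟩
    exact single_self_mul_mem_basisSpan hΔ hΓ (Nat.lt_succ_iff.1 hab) hP hP'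
  · obtain ⟨ε, rfl, rfl⟩ := exists_sgn_of_ne hij
    refine single_mem_of_mem_span ?_ (diffOps_inf_compatibleMaps_le_span
      (isAdapted_xFactor hΔ ε) (isAdapted_yFactor hΓ ε) (k + 1) mem_inf)
    rintro _ ⟨a, b, hab, P, hP, order_P, P', hP', order_P', rfl⟩
    exact mem_basisSpan (single_mem_basisR hΔ hΓ hP hP') (orderLE_single _ _
      (mul_mem_diffOps_of_add_le (Nat.lt_succ_iff.1 hab) order_P order_P'))

end Complement

end RectMod

end

theorem mainTheorem10 (U : TopologicalSpace.Opens (ℂ × ℂ)) (n m Δ Γ : ℕ)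
    (hΔ : Δ ≤ n) (hΓ : Γ ≤ m) (k : ℕ) (D : RectMod.MatOp U)
    (hD : D ∈ RectMod.complementR U n m Δ Γ) (hk : RectMod.OrderLE U k D) :
    D ∈ Submodule.span ℂ {M | M ∈ RectMod.basisR U n m Δ Γ ∧ RectMod.OrderLE U k M} := by
  rw [Matrix.matrix_eq_sum_single D]
  exact sum_mem fun i _ => sum_mem fun j _ => RectMod.single_entry_mem_basisSpan hΔ hΓ hD hk i j
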